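/- Let $K$ be a commutative ring. A dg-module is a $\mathbb Z$-graded chain complex of $K$-modules (differential of degree $-1$), a $\Sigma_*$-module is a sequence $M(n)$, $n\ge 0$, of dg-modules with actions of the symmetric groups $\Sigma_n$, and $\circ$ is the composition product of $\Sigma_*$-modules (with the Koszul sign rule). Let $\mathsf P$ and $\mathsf Q$ be operads in dg-modules that are connected, i.e. $\mathsf P(0)=\mathsf Q(0)=0$ and $\mathsf P(1)=\mathsf Q(1)=K$ (in degree $0$, spanned by the unit). Call a morphism of $\Sigma_*$-modules, or of $\mathsf P$-$\mathsf Q$-bimodules, an acyclic fibration if it is surjective and a quasi-isomorphism in every arity. Let $M$ be a cofibrant $\Sigma_*$-module with $M(0)=0$, where cofibrant means that $0\to M$ has the left lifting property with respect to all acyclic fibrations of $\Sigma_*$-modules. Let $\delta$ be the differential of the free bimodule $\mathsf P\circ M\circ\mathsf Q$, and let $\partial$ be an equivariant homomorphism of degree $-1$ of $\mathsf P\circ M\circ\mathsf Q$ with $\delta\partial+\partial\delta+\partial^2=0$ such that $\mathsf P\circ M\circ \mathsf Q$, with the actions of $\mathsf P$ and $\mathsf Q$ of the free bimodule and with the differential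 $\delta+\partial$, is a $\mathsf P$-$\mathsf Q$-bimodule in dg-modules; it is denoted by $(\mathsf P\circ M\circ\mathsf Q,\partial)$ and called quasi-free. Suppose that $\partial$ is decomposable, i.e. that $$\partial(M)\subset \bar{\mathsf P}\circ M\circ\mathsf Q+\mathsf P\circ M\circ\bar{\mathsf Q},$$ where $\bar{\mathsf P}\circ M\circ\mathsf Q$ is spanned by the composites $p(m_1(q_{11},\dots),\dots,m_k(q_{k1},\dots))$ in which $p$ has arity $>1$, and $\mathsf P\circ M\circ\bar{\mathsf Q}$ by those in which at least one $q_{ts}$ has arity $>1$. Then $(\mathsf P\circ M\circ\mathsf Q,\partial)$ is a cofibrant $\mathsf P$-$\mathsf Q$-bimodule: the morphism from $0$ to it has the left lifting property with respect to all acyclic fibrations between $\mathsf P$-$\mathsf Q$-bimodules $X$ with $X(0)=0$. -/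

import Mathlib

universe u

noncomputable section

/-! ### Graded `Σ_*`-modules and the composition product -/

/-- A `ℤ`-graded `Σ_*`-module over `K`: for every arity `n` and every degree `d` a `K`-module
`obj n d` with a linear action of the symmetric group `Σ_n`.  The action is written on the left:
`act n d σ x` is the element `x` whose `i`-th input is relabelled `σ i` (the corresponding right
action is `x · σ = σ⁻¹ x`). -/
structure GrSym (K : Type u) [CommRing K] where
  obj : ℕ → ℤ → Type u
  [acg : ∀ n d, AddCommGroup (obj n d)]
  [mod : ∀ n d, Module K (obj n d)]
  act : ∀ n d, Representation K (Equiv.Perm (Fin n)) (obj n d)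

attribute [instance] GrSym.acg GrSym.mod

/-- Homogeneous elements of arity `n`, of any degree (the degree is the first component). -/
abbrev GrSym.Homog {K : Type u} [CommRing K] (B : GrSym K) (n : ℕ) : Type u :=
  Σ d : ℤ, B.obj n d

/-- The permutation action on homogeneous elements. -/
def GrSym.hact {K : Type u} [CommRing K] (B : GrSym K) {n : ℕ} (τ : Equiv.Perm (Fin n))
    (x : B.Homog n) : B.Homog n :=
  ⟨x.1, B.act n x.1 τ x.2⟩

/-- The Koszul sign of the reordering `x_1, …, x_k ↦ x_{σ 1}, …, x_{σ k}` of homogeneous elements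
of degrees `d_1, …, d_k`. -/
def koszulSign {k : ℕ} (σ : Equiv.Perm (Fin k)) (d : Fin k → ℤ) : ℤˣ :=
  (∑ s, ∑ t, if s < t ∧ σ t < σ s then d (σ s) * d (σ t) else 0).negOnePow

/-- The generators of `(A ∘ B)(n)` in degree `D`: an element `a ∈ A(k)`, elements
`b_t ∈ B(l_t)` plugged into the inputs `t` of `a`, and a labelling `e` of the remaining inputs by
`1, …, n`. -/
structure Comp.Gen {K : Type u} [CommRing K] (A B : GrSym K) (n : ℕ) (D : ℤ) : Type u where
  {k : ℕ}
  {i : ℤ}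
  a : A.obj k i
  {l : Fin k → ℕ}
  b : ∀ t, B.Homog (l t)
  e : (Σ t, Fin (l t)) ≃ Fin n
  h : i + ∑ t, (b t).1 = D

/-- The defining relations of `A ∘ B`, as pairs of equal elements: multilinearity, and invariance
under the permutations of the inputs of the `b_t` and under the permutations of the inputs of
`a` (with the Koszul sign of the permutation of the `b_t`). -/
inductive Comp.Rel {K : Type u} [CommRing K] (A B : GrSym K) (n : ℕ) (D : ℤ) :
    (Comp.Gen A B n D →₀ K) → (Comp.Gen A B n D →₀ K) → Prop
  | add_left {k : ℕ} {i : ℤ} (a a' : A.obj k i) {l : Fin k → ℕ} (b : ∀ t, B.Homog (l t))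
      (e : (Σ t, Fin (l t)) ≃ Fin n) (h : i + ∑ t, (b t).1 = D) :
      Comp.Rel A B n D (Finsupp.single ⟨a + a', b, e, h⟩ 1)
        (Finsupp.single ⟨a, b, e, h⟩ 1 + Finsupp.single ⟨a', b, e, h⟩ 1)
  | smul_left {k : ℕ} {i : ℤ} (r : K) (a : A.obj k i) {l : Fin k → ℕ} (b : ∀ t, B.Homog (l t))
      (e : (Σ t, Fin (l t)) ≃ Fin n) (h : i + ∑ t, (b t).1 = D) :
      Comp.Rel A B n D (Finsupp.single ⟨r • a, b, e, h⟩ 1)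
        (r • Finsupp.single ⟨a, b, e, h⟩ 1)
  | add_right {k : ℕ} {i : ℤ} (a : A.obj k i) {l : Fin k → ℕ} (b : ∀ t, B.Homog (l t))
      (e : (Σ t, Fin (l t)) ≃ Fin n) (t : Fin k) (d : ℤ) (x y : B.obj (l t) d)
      (h : i + ∑ s, (Function.update b t ⟨d, x + y⟩ s).1 = D)
      (hx : i + ∑ s, (Function.update b t ⟨d, x⟩ s).1 = D)
      (hy : i + ∑ s, (Function.update b t ⟨d, y⟩ s).1 = D) :
      Comp.Rel A B n D (Finsupp.single ⟨a, Function.update b t ⟨d, x + y⟩, e, h⟩ 1)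
        (Finsupp.single ⟨a, Function.update b t ⟨d, x⟩, e, hx⟩ 1 +
          Finsupp.single ⟨a, Function.update b t ⟨d, y⟩, e, hy⟩ 1)
  | smul_right {k : ℕ} {i : ℤ} (a : A.obj k i) {l : Fin k → ℕ} (b : ∀ t, B.Homog (l t))
      (e : (Σ t, Fin (l t)) ≃ Fin n) (t : Fin k) (d : ℤ) (r : K) (x : B.obj (l t) d)
      (h : i + ∑ s, (Function.update b t ⟨d, r • x⟩ s).1 = D)
      (hx : i + ∑ s, (Function.update b t ⟨d, x⟩ s).1 = D) :
      Comp.Rel A B n D (Finsupp.single ⟨a, Function.update b t ⟨d, r • x⟩, e, h⟩ 1)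
        (r • Finsupp.single ⟨a, Function.update b t ⟨d, x⟩, e, hx⟩ 1)
  | act_right {k : ℕ} {i : ℤ} (a : A.obj k i) {l : Fin k → ℕ} (b : ∀ t, B.Homog (l t))
      (e : (Σ t, Fin (l t)) ≃ Fin n) (τ : ∀ t, Equiv.Perm (Fin (l t)))
      (h : i + ∑ t, (B.hact (τ t) (b t)).1 = D) (h' : i + ∑ t, (b t).1 = D) :
      Comp.Rel A B n D (Finsupp.single ⟨a, fun t => B.hact (τ t) (b t), e, h⟩ 1)
        (Finsupp.single ⟨a, b, (Equiv.sigmaCongrRight τ).trans e, h'⟩ 1)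
  | act_left {k : ℕ} {i : ℤ} (a : A.obj k i) {l : Fin k → ℕ} (b : ∀ t, B.Homog (l t))
      (e : (Σ t, Fin (l t)) ≃ Fin n) (σ : Equiv.Perm (Fin k))
      (h : i + ∑ t, (b t).1 = D) (h' : i + ∑ t, (b (σ t)).1 = D) :
      Comp.Rel A B n D (Finsupp.single ⟨A.act k i σ a, b, e, h⟩ 1)
        (koszulSign σ (fun t => (b t).1) • Finsupp.single
          ⟨a, fun t => b (σ t),
            (Equiv.sigmaCongrLeft (β := fun t => Fin (l t)) σ).trans e, h'⟩ 1)

/-- The submodule of relations. -/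
def Comp.relSubmodule {K : Type u} [CommRing K] (A B : GrSym K) (n : ℕ) (D : ℤ) :
    Submodule K (Comp.Gen A B n D →₀ K) :=
  Submodule.span K {z | ∃ x y, Comp.Rel A B n D x y ∧ z = x - y}

/-- The component of arity `n` and degree `D` of the composition product `A ∘ B`, i.e. of
`⨁_k A(k) ⊗_{Σ_k} (⨁_{l_1 + … + l_k = n} Ind_{Σ_{l_1} × … × Σ_{l_k}}^{Σ_n} B(l_1) ⊗ … ⊗ B(l_k))`. -/
abbrev Comp.Obj {K : Type u} [CommRing K] (A B : GrSym K) (n : ℕ) (D : ℤ) : Type u :=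
  (Comp.Gen A B n D →₀ K) ⧸ Comp.relSubmodule A B n D

/-- The class in `A ∘ B` of a generator. -/
def Comp.gen {K : Type u} [CommRing K] {A B : GrSym K} {n : ℕ} {D : ℤ}
    (g : Comp.Gen A B n D) : Comp.Obj A B n D :=
  (Comp.relSubmodule A B n D).mkQ (Finsupp.single g 1)

/-- The element `a(b_1, …, b_k)` of `A ∘ B`, with inputs labelled through `e`. -/
abbrev Comp.mk {K : Type u} [CommRing K] {A B : GrSym K} {n : ℕ} {D : ℤ} {k : ℕ} {i : ℤ}
    (a : A.obj k i) {l : Fin k → ℕ} (b : ∀ t, B.Homog (l t)) (e : (Σ t, Fin (l t)) ≃ Fin n)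
    (h : i + ∑ t, (b t).1 = D) : Comp.Obj A B n D :=
  Comp.gen ⟨a, b, e, h⟩

theorem Comp.rel_eq {K : Type u} [CommRing K] {A B : GrSym K} {n : ℕ} {D : ℤ}
    {x y : Comp.Gen A B n D →₀ K} (h : Comp.Rel A B n D x y) :
    (Comp.relSubmodule A B n D).mkQ x = (Comp.relSubmodule A B n D).mkQ y := by
  rw [← sub_eq_zero, ← map_sub, Submodule.mkQ_apply, Submodule.Quotient.mk_eq_zero]
  exact Submodule.subset_span ⟨x, y, h, rfl⟩

theorem Comp.mk_congr {K : Type u} [CommRing K] {A B : GrSym K} {n : ℕ} {D : ℤ} {k : ℕ} {i : ℤ}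
    (a : A.obj k i) {l : Fin k → ℕ} {b b' : ∀ t, B.Homog (l t)} (hb : b = b')
    (e : (Σ t, Fin (l t)) ≃ Fin n) (h : i + ∑ t, (b t).1 = D) (h' : i + ∑ t, (b' t).1 = D) :
    Comp.mk a b e h = Comp.mk a b' e h' := by
  subst hb; rfl

theorem Comp.mk_add_left {K : Type u} [CommRing K] {A B : GrSym K} {n : ℕ} {D : ℤ} {k : ℕ}
    {i : ℤ} (a a' : A.obj k i) {l : Fin k → ℕ} (b : ∀ t, B.Homog (l t))
    (e : (Σ t, Fin (l t)) ≃ Fin n) (h : i + ∑ t, (b t).1 = D) :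
    Comp.mk (a + a') b e h = Comp.mk a b e h + Comp.mk a' b e h := by
  have := Comp.rel_eq (Comp.Rel.add_left a a' b e h)
  rw [map_add] at this
  exact this

theorem Comp.mk_smul_left {K : Type u} [CommRing K] {A B : GrSym K} {n : ℕ} {D : ℤ} {k : ℕ}
    {i : ℤ} (r : K) (a : A.obj k i) {l : Fin k → ℕ} (b : ∀ t, B.Homog (l t))
    (e : (Σ t, Fin (l t)) ≃ Fin n) (h : i + ∑ t, (b t).1 = D) :
    Comp.mk (r • a) b e h = r • Comp.mk a b e h := by
  have := Comp.rel_eq (Comp.Rel.smul_left r a b e h)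
  rw [map_smul] at this
  exact this

theorem Comp.mk_add_right {K : Type u} [CommRing K] {A B : GrSym K} {n : ℕ} {D : ℤ} {k : ℕ}
    {i : ℤ} (a : A.obj k i) {l : Fin k → ℕ} (b : ∀ t, B.Homog (l t))
    (e : (Σ t, Fin (l t)) ≃ Fin n) (t : Fin k) (d : ℤ) (x y : B.obj (l t) d)
    (h : i + ∑ s, (Function.update b t ⟨d, x + y⟩ s).1 = D)
    (hx : i + ∑ s, (Function.update b t ⟨d, x⟩ s).1 = D)
    (hy : i + ∑ s, (Function.update b t ⟨d, y⟩ s).1 = D) :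
    Comp.mk a (Function.update b t ⟨d, x + y⟩) e h =
      Comp.mk a (Function.update b t ⟨d, x⟩) e hx +
        Comp.mk a (Function.update b t ⟨d, y⟩) e hy := by
  have := Comp.rel_eq (Comp.Rel.add_right a b e t d x y h hx hy)
  rw [map_add] at this
  exact this

theorem Comp.mk_smul_right {K : Type u} [CommRing K] {A B : GrSym K} {n : ℕ} {D : ℤ} {k : ℕ}
    {i : ℤ} (a : A.obj k i) {l : Fin k → ℕ} (b : ∀ t, B.Homog (l t))
    (e : (Σ t, Fin (l t)) ≃ Fin n) (t : Fin k) (d : ℤ) (r : K) (x : B.obj (l t) d)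
    (h : i + ∑ s, (Function.update b t ⟨d, r • x⟩ s).1 = D)
    (hx : i + ∑ s, (Function.update b t ⟨d, x⟩ s).1 = D) :
    Comp.mk a (Function.update b t ⟨d, r • x⟩) e h =
      r • Comp.mk a (Function.update b t ⟨d, x⟩) e hx := by
  have := Comp.rel_eq (Comp.Rel.smul_right a b e t d r x h hx)
  rw [map_smul] at this
  exact this

theorem Comp.mk_act_right {K : Type u} [CommRing K] {A B : GrSym K} {n : ℕ} {D : ℤ} {k : ℕ}
    {i : ℤ} (a : A.obj k i) {l : Fin k → ℕ} (b : ∀ t, B.Homog (l t))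
    (e : (Σ t, Fin (l t)) ≃ Fin n) (τ : ∀ t, Equiv.Perm (Fin (l t)))
    (h : i + ∑ t, (B.hact (τ t) (b t)).1 = D) (h' : i + ∑ t, (b t).1 = D) :
    Comp.mk a (fun t => B.hact (τ t) (b t)) e h =
      Comp.mk a b ((Equiv.sigmaCongrRight τ).trans e) h' :=
  Comp.rel_eq (Comp.Rel.act_right a b e τ h h')

theorem Comp.mk_act_left {K : Type u} [CommRing K] {A B : GrSym K} {n : ℕ} {D : ℤ} {k : ℕ}
    {i : ℤ} (a : A.obj k i) {l : Fin k → ℕ} (b : ∀ t, B.Homog (l t))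
    (e : (Σ t, Fin (l t)) ≃ Fin n) (σ : Equiv.Perm (Fin k))
    (h : i + ∑ t, (b t).1 = D) (h' : i + ∑ t, (b (σ t)).1 = D) :
    Comp.mk (A.act k i σ a) b e h =
      koszulSign σ (fun t => (b t).1) • Comp.mk a (fun t => b (σ t))
        ((Equiv.sigmaCongrLeft (β := fun t => Fin (l t)) σ).trans e) h' := by
  have := Comp.rel_eq (Comp.Rel.act_left a b e σ h h')
  rw [Units.smul_def, map_zsmul, ← Units.smul_def] at this
  exact this

/-- Linear maps out of `A ∘ B`: a function on generators compatible with the relations. -/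
def Comp.lift {K : Type u} [CommRing K] {A B : GrSym K} {n : ℕ} {D : ℤ} {W : Type u}
    [AddCommGroup W] [Module K W] (φ : Comp.Gen A B n D → W)
    (hφ : ∀ x y, Comp.Rel A B n D x y →
      Finsupp.linearCombination K φ x = Finsupp.linearCombination K φ y) :
    Comp.Obj A B n D →ₗ[K] W :=
  (Comp.relSubmodule A B n D).liftQ (Finsupp.linearCombination K φ) (by
    rw [Comp.relSubmodule, Submodule.span_le]
    rintro z ⟨x, y, h, rfl⟩
    simp [hφ x y h])

@[simp]
theorem Comp.lift_gen {K : Type u} [CommRing K] {A B : GrSym K} {n : ℕ} {D : ℤ} {W : Type u}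
    [AddCommGroup W] [Module K W] (φ : Comp.Gen A B n D → W)
    (hφ : ∀ x y, Comp.Rel A B n D x y →
      Finsupp.linearCombination K φ x = Finsupp.linearCombination K φ y)
    (g : Comp.Gen A B n D) : Comp.lift φ hφ (Comp.gen g) = φ g := by
  simp [Comp.lift, Comp.gen]

theorem Comp.hom_ext {K : Type u} [CommRing K] {A B : GrSym K} {n : ℕ} {D : ℤ} {W : Type u}
    [AddCommGroup W] [Module K W] {f g : Comp.Obj A B n D →ₗ[K] W}
    (h : ∀ x, f (Comp.gen x) = g (Comp.gen x)) : f = g := by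
  apply Submodule.linearMap_qext
  apply Finsupp.lhom_ext'
  intro x
  apply LinearMap.ext_ring
  exact h x

/-- Relabelling of the inputs of a generator. -/
def Comp.Gen.relabel {K : Type u} [CommRing K] {A B : GrSym K} {n : ℕ} {D : ℤ}
    (σ : Equiv.Perm (Fin n)) (g : Comp.Gen A B n D) : Comp.Gen A B n D :=
  ⟨g.a, g.b, g.e.trans σ, g.h⟩

/-- The action of `Σ_n` on `(A ∘ B)(n)`, by relabelling. -/
def Comp.actMap {K : Type u} [CommRing K] (A B : GrSym K) (n : ℕ) (D : ℤ)
    (σ : Equiv.Perm (Fin n)) : Comp.Obj A B n D →ₗ[K] Comp.Obj A B n D :=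
  Comp.lift (fun g => Comp.gen (g.relabel σ)) (by
    intro x y h
    cases h with
    | add_left a a' b e h =>
      simp only [map_add, Finsupp.linearCombination_single, one_smul]
      exact Comp.mk_add_left a a' b (e.trans σ) h
    | smul_left r a b e h =>
      simp only [map_smul, Finsupp.linearCombination_single, one_smul]
      exact Comp.mk_smul_left r a b (e.trans σ) h
    | add_right a b e t d x y h hx hy =>
      simp only [map_add, Finsupp.linearCombination_single, one_smul]
      exact Comp.mk_add_right a b (e.trans σ) t d x y h hx hy
    | smul_right a b e t d r x h hx =>
      simp only [map_smul, Finsupp.linearCombination_single, one_smul]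
      exact Comp.mk_smul_right a b (e.trans σ) t d r x h hx
    | act_right a b e τ h h' =>
      simp only [Finsupp.linearCombination_single, one_smul]
      exact Comp.mk_act_right a b (e.trans σ) τ h h'
    | act_left a b e τ h h' =>
      rw [Units.smul_def, map_zsmul, ← Units.smul_def]
      simp only [Finsupp.linearCombination_single, one_smul]
      exact Comp.mk_act_left a b (e.trans σ) τ h h')

/-- The composition product `A ∘ B` of graded `Σ_*`-modules. -/
abbrev GrSym.comp {K : Type u} [CommRing K] (A B : GrSym K) : GrSym K where
  obj n D := Comp.Obj A B n D
  act n D :=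
    { toFun := Comp.actMap A B n D
      map_one' := by
        apply Comp.hom_ext; intro g; simp only [Comp.actMap, Comp.lift_gen]; rfl
      map_mul' := by
        intro σ τ; apply Comp.hom_ext; intro g
        simp only [Comp.actMap, Comp.lift_gen, Module.End.mul_apply]; rfl }

/-! ### Differentials -/

/-- The homomorphisms `X → X` of degree `-1` of graded `Σ_*`-modules: families of `K`-linear maps
`X(n)_i → X(n)_{i-1}` commuting with the actions of the symmetric groups. -/
@[ext]
structure GrSym.DegEnd {K : Type u} [CommRing K] (X : GrSym K) where
  map : ∀ (n : ℕ) (i j : ℤ), j + 1 = i → (X.obj n i →ₗ[K] X.obj n j)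
  map_act : ∀ (n : ℕ) (i j : ℤ) (h : j + 1 = i) (σ : Equiv.Perm (Fin n)) (x : X.obj n i),
    map n i j h (X.act n i σ x) = X.act n j σ (map n i j h x)

/-- A homomorphism of degree `-1`, applied to homogeneous elements. -/
def GrSym.DegEnd.homog {K : Type u} [CommRing K] {X : GrSym K} (δ : X.DegEnd) {n : ℕ}
    (x : X.Homog n) : X.Homog n :=
  ⟨x.1 - 1, δ.map n x.1 (x.1 - 1) (by ring) x.2⟩

/-- The sign `(-1)^{i + d_1 + … + d_{t-1}}`. -/
def prefixSign {k : ℕ} (i : ℤ) (d : Fin k → ℤ) (t : Fin k) : ℤˣ :=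
  (i + ∑ s, if s < t then d s else 0).negOnePow

theorem Comp.fst_update {K : Type u} [CommRing K] {B : GrSym K} {k : ℕ} {l : Fin k → ℕ}
    (b : ∀ t, B.Homog (l t)) (t : Fin k) (x : B.Homog (l t)) :
    (fun s => (Function.update b t x s).1) = Function.update (fun s => (b s).1) t x.1 := by
  funext s
  exact Function.apply_update (fun _ y => y.1) b t x s

theorem Comp.sum_update {k : ℕ} (d : Fin k → ℤ) (t : Fin k) (z : ℤ) :
    ∑ s, Function.update d t z s = z - d t + ∑ s, d s := by
  rw [Finset.sum_update_of_mem (Finset.mem_univ t),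
    ← Finset.sum_sdiff (Finset.subset_univ ({t} : Finset (Fin k)))]
  simp
  ring

theorem Comp.deg_update {K : Type u} [CommRing K] {B : GrSym K} {k : ℕ} {l : Fin k → ℕ}
    {i D D' : ℤ} (hD : D' + 1 = D) (β : B.DegEnd)
    (b : ∀ t, B.Homog (l t)) (h : i + ∑ t, (b t).1 = D) (t : Fin k) :
    i + ∑ s, (Function.update b t (β.homog (b t)) s).1 = D' := by
  have : ∑ s, (Function.update b t (β.homog (b t)) s).1 = (b t).1 - 1 - (b t).1 + ∑ s, (b s).1 := by
    rw [Comp.fst_update, Comp.sum_update]; rfl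
  rw [this]; linarith

/-- The differential of a generator of `A ∘ B`:
`δ(a(b_1, …, b_k)) = (δa)(b_1, …, b_k) + ∑_t ± a(b_1, …, δ b_t, …, b_k)`, with the sign
`(-1)^{|a| + |b_1| + … + |b_{t-1}|}`. -/
def Comp.dGen {K : Type u} [CommRing K] {A B : GrSym K} (α : A.DegEnd) (β : B.DegEnd)
    {n : ℕ} {D D' : ℤ} (hD : D' + 1 = D) (g : Comp.Gen A B n D) : Comp.Obj A B n D' :=
  Comp.mk (α.map g.k g.i (g.i - 1) (by ring) g.a) g.b g.e (by have := g.h; linarith) +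
    ∑ t, prefixSign g.i (fun s => (g.b s).1) t •
      Comp.mk g.a (Function.update g.b t (β.homog (g.b t))) g.e
        (Comp.deg_update hD β g.b g.h t)

theorem prefixSign_congr {k : ℕ} {i i' : ℤ} {d d' : Fin k → ℤ} {t : Fin k}
    (h : (i + ∑ s, if s < t then d s else 0) = i' + ∑ s, if s < t then d' s else 0) :
    prefixSign i d t = prefixSign i' d' t := by
  rw [prefixSign, prefixSign, h]

theorem prefixSign_update_of_le {k : ℕ} (i : ℤ) (d : Fin k → ℤ) {s t : Fin k} (h : t ≤ s) (z : ℤ) :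
    prefixSign i (Function.update d s z) t = prefixSign i d t := by
  apply prefixSign_congr
  congr 1
  apply Finset.sum_congr rfl
  intro u _
  split_ifs with hu
  · rw [Function.update_of_ne]; rintro rfl; exact absurd hu (not_lt.mpr h)
  · rfl

theorem prefixSign_update_of_lt {k : ℕ} (i : ℤ) (d : Fin k → ℤ) {s t : Fin k} (h : s < t) :
    prefixSign i (Function.update d s (d s - 1)) t = -prefixSign i d t := by
  have : (∑ u, if u < t then Function.update d s (d s - 1) u else 0) =
      (∑ u, if u < t then d u else 0) - 1 := by
    have h1 : ∀ u, (if u < t then Function.update d s (d s - 1) u else 0) =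
        (if u < t then d u else 0) - (if u = s then 1 else 0) := by
      intro u
      by_cases hu : u = s
      · subst hu; simp [h]
      · simp [hu]
    rw [Finset.sum_congr rfl (fun u _ => h1 u), Finset.sum_sub_distrib]
    simp
  rw [prefixSign, prefixSign, this, ← add_sub_assoc, Int.negOnePow_sub]
  simp

/-- Compatibility of the Koszul signs of permutations and of differentials. -/
theorem koszulSign_prefixSign {k : ℕ} (σ : Equiv.Perm (Fin k)) (i : ℤ) (d : Fin k → ℤ)
    (u : Fin k) :
    prefixSign i d (σ u) * koszulSign σ (Function.update d (σ u) (d (σ u) - 1)) =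
      koszulSign σ d * prefixSign i (fun t => d (σ t)) u := by
  set f : Fin k → ℤ := fun t => d (σ t) with hf
  set c : Fin k → Fin k → ℤ := fun s t => if s < t ∧ σ t < σ s then 1 else 0 with hc
  have hup : ∀ s, Function.update d (σ u) (d (σ u) - 1) (σ s) = f s - if s = u then 1 else 0 := by
    intro s
    by_cases hs : s = u
    · subst hs; simp [hf]
    · simp [hs, hf]
  have hcu : c u u = 0 := by simp [hc]
  have E' : (∑ s, ∑ t, if s < t ∧ σ t < σ s then
      Function.update d (σ u) (d (σ u) - 1) (σ s) * Function.update d (σ u) (d (σ u) - 1) (σ t)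
      else 0) = (∑ s, ∑ t, if s < t ∧ σ t < σ s then d (σ s) * d (σ t) else 0)
        - ∑ t, c u t * f t - ∑ s, c s u * f s := by
    have h1 : ∀ s t, (if s < t ∧ σ t < σ s then
      Function.update d (σ u) (d (σ u) - 1) (σ s) * Function.update d (σ u) (d (σ u) - 1) (σ t)
      else 0) = (if s < t ∧ σ t < σ s then d (σ s) * d (σ t) else 0)
        - (if s = u then c s t * f t else 0) - (if t = u then c s t * f s else 0)
        + (if s = u then if t = u then c s t else 0 else 0) := by
      intro s t
      rw [hup, hup]
      simp only [hc]
      split_ifs <;> simp [hf] <;> ring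
    simp_rw [h1, Finset.sum_add_distrib, Finset.sum_sub_distrib]
    have e1 : ∑ s, ∑ t, (if s = u then c s t * f t else 0) = ∑ t, c u t * f t := by
      rw [Finset.sum_comm]; simp
    have e2 : ∑ s, ∑ t, (if t = u then c s t * f s else 0) = ∑ s, c s u * f s := by simp
    have e3 : ∑ s, ∑ t, (if s = u then if t = u then c s t else 0 else 0) = 0 := by
      rw [Finset.sum_comm]; simp [hcu]
    rw [e1, e2, e3]; ring
  have E2 : (∑ s, if s < σ u then d s else 0) =
      (∑ v, if v < u then f v else 0) + ∑ v, c u v * f v - ∑ v, c v u * f v := by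
    rw [← Equiv.sum_comp σ, ← Finset.sum_add_distrib, ← Finset.sum_sub_distrib]
    apply Finset.sum_congr rfl
    intro v _
    simp only [hc]
    rcases lt_trichotomy v u with h | h | h
    · have h' : ¬ u < v := not_lt.mpr h.le
      rcases lt_trichotomy (σ v) (σ u) with g | g | g
      · simp [h, h', g, not_lt.mpr g.le, hf]
      · exact absurd (σ.injective g) h.ne
      · simp [h, h', g, not_lt.mpr g.le, hf]
    · subst h; simp
    · have h' : ¬ v < u := not_lt.mpr h.le
      rcases lt_trichotomy (σ v) (σ u) with g | g | g
      · simp [h, h', g, not_lt.mpr g.le, hf]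
      · exact absurd (σ.injective g) h.ne'
      · simp [h, h', g, not_lt.mpr g.le, hf]
  rw [prefixSign, prefixSign, koszulSign, koszulSign, ← Int.negOnePow_add, ← Int.negOnePow_add,
    Int.negOnePow_eq_iff, E', E2]
  refine ⟨- ∑ v, c v u * f v, ?_⟩
  ring

theorem Comp.units_smul_comm {K : Type u} [CommRing K] {W : Type u} [AddCommGroup W] [Module K W]
    (ε : ℤˣ) (r : K) (x : W) : ε • r • x = r • ε • x := by
  rw [Units.smul_def, Units.smul_def, smul_comm]

theorem Comp.mk_zero_right {K : Type u} [CommRing K] {A B : GrSym K} {n : ℕ} {D : ℤ} {k : ℕ}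
    {i : ℤ} (a : A.obj k i) {l : Fin k → ℕ} (b : ∀ t, B.Homog (l t))
    (e : (Σ t, Fin (l t)) ≃ Fin n) (t : Fin k) (d : ℤ)
    (h : i + ∑ s, (Function.update b t ⟨d, 0⟩ s).1 = D) :
    Comp.mk a (Function.update b t ⟨d, 0⟩) e h = 0 := by
  have h0 : i + ∑ s, (Function.update b t ⟨d, (0 : K) • 0⟩ s).1 = D := by
    rw [zero_smul]; exact h
  have := Comp.mk_smul_right a b e t d (0 : K) 0 h0 h
  rw [zero_smul K (Comp.mk _ _ _ _)] at this
  rw [← this]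
  exact Comp.mk_congr a (by rw [zero_smul]) e h h0

theorem Comp.mk_zero_left {K : Type u} [CommRing K] {A B : GrSym K} {n : ℕ} {D : ℤ} {k : ℕ}
    {i : ℤ} {l : Fin k → ℕ} (b : ∀ t, B.Homog (l t))
    (e : (Σ t, Fin (l t)) ≃ Fin n) (h : i + ∑ t, (b t).1 = D) :
    Comp.mk (0 : A.obj k i) b e h = 0 := by
  have := Comp.mk_smul_left (0 : K) (0 : A.obj k i) b e h
  rwa [zero_smul, zero_smul] at this

/-- The part of the differential on the `t`-th factor, in a form that depends only on the degrees
through `d`. -/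
theorem Comp.dGen_eq {K : Type u} [CommRing K] {A B : GrSym K} (α : A.DegEnd) (β : B.DegEnd)
    {n : ℕ} {D D' : ℤ} (hD : D' + 1 = D) {k : ℕ} {i : ℤ} (a : A.obj k i) {l : Fin k → ℕ}
    (b : ∀ t, B.Homog (l t)) (e : (Σ t, Fin (l t)) ≃ Fin n) (h : i + ∑ t, (b t).1 = D)
    (d : Fin k → ℤ) (hd : (fun s => (b s).1) = d) (h' : i - 1 + ∑ t, (b t).1 = D')
    (h'' : ∀ t, i + ∑ s, (Function.update b t (β.homog (b t)) s).1 = D') :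
    Comp.dGen α β hD ⟨a, b, e, h⟩ =
      Comp.mk (α.map k i (i - 1) (by ring) a) b e h' +
        ∑ t, prefixSign i d t •
          Comp.mk a (Function.update b t (β.homog (b t))) e (h'' t) := by
  subst hd; rfl

theorem GrSym.DegEnd.homog_hact {K : Type u} [CommRing K] {B : GrSym K} (β : B.DegEnd) {n : ℕ}
    (τ : Equiv.Perm (Fin n)) (x : B.Homog n) :
    β.homog (B.hact τ x) = B.hact τ (β.homog x) := by
  obtain ⟨d, x⟩ := x
  exact congrArg (fun z => (⟨d - 1, z⟩ : B.Homog n)) (β.map_act n d (d - 1) (by ring) τ x)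

theorem Comp.dGen_rel {K : Type u} [CommRing K] {A B : GrSym K} (α : A.DegEnd) (β : B.DegEnd)
    {n : ℕ} {D D' : ℤ} (hD : D' + 1 = D) (x y : Comp.Gen A B n D →₀ K)
    (h : Comp.Rel A B n D x y) :
    Finsupp.linearCombination K (Comp.dGen α β hD) x =
      Finsupp.linearCombination K (Comp.dGen α β hD) y := by
  cases h with
  | add_left a a' b e h =>
    simp only [map_add, Finsupp.linearCombination_single, one_smul, Comp.dGen]
    rw [Comp.mk_add_left]
    simp_rw [Comp.mk_add_left, smul_add, Finset.sum_add_distrib]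
    abel
  | smul_left r a b e h =>
    simp only [map_smul, Finsupp.linearCombination_single, one_smul, Comp.dGen]
    rw [Comp.mk_smul_left, smul_add, Finset.smul_sum]
    simp_rw [Comp.mk_smul_left, Comp.units_smul_comm]
  | @add_right k i a l b e t d x y h hx hy =>
    simp only [map_add, Finsupp.linearCombination_single, one_smul]
    have hh : ∀ z : B.obj (l t) d, i + ∑ s, (Function.update b t ⟨d, z⟩ s).1 = D := by
      intro z; rw [Comp.fst_update] at hx ⊢; exact hx
    have hdeg : ∀ z : B.obj (l t) d, (fun s => (Function.update b t (⟨d, z⟩ : B.Homog (l t)) s).1) =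
        Function.update (fun s => (b s).1) t d := fun z => Comp.fst_update b t ⟨d, z⟩
    have h1 : ∀ z : B.obj (l t) d, i - 1 + ∑ s, (Function.update b t ⟨d, z⟩ s).1 = D' := by
      intro z; have := hh z; linarith
    rw [Comp.dGen_eq α β hD a _ e h _ (hdeg _) (h1 _) (fun u => Comp.deg_update hD β _ (hh _) u),
      Comp.dGen_eq α β hD a _ e hx _ (hdeg _) (h1 _) (fun u => Comp.deg_update hD β _ (hh _) u),
      Comp.dGen_eq α β hD a _ e hy _ (hdeg _) (h1 _) (fun u => Comp.deg_update hD β _ (hh _) u),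
      Comp.mk_add_right _ b e t d x y (h1 _) (h1 _) (h1 _), add_add_add_comm,
      ← Finset.sum_add_distrib]
    congr 1
    apply Finset.sum_congr rfl
    intro u _
    rw [← smul_add]
    congr 1
    by_cases hu : u = t
    · subst hu
      have hv : ∀ z : B.obj (l u) d, Function.update (Function.update b u ⟨d, z⟩) u
          (β.homog (Function.update b u (⟨d, z⟩ : B.Homog (l u)) u)) =
          Function.update b u ⟨d - 1, β.map (l u) d (d - 1) (by ring) z⟩ := by
        intro z; rw [Function.update_idem, Function.update_self]; rfl
      have hD' : ∀ z : B.obj (l u) d, i + ∑ s, (Function.update b u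
          (⟨d - 1, β.map (l u) d (d - 1) (by ring) z⟩ : B.Homog (l u)) s).1 = D' := by
        intro z; rw [← hv]; exact Comp.deg_update hD β _ (hh _) u
      rw [Comp.mk_congr a (hv (x + y)) e _ (hD' _), Comp.mk_congr a (hv x) e _ (hD' _),
        Comp.mk_congr a (hv y) e _ (hD' _)]
      have hD2 : i + ∑ s, (Function.update b u
          (⟨d - 1, β.map (l u) d (d - 1) (by ring) x + β.map (l u) d (d - 1) (by ring) y⟩ :
            B.Homog (l u)) s).1 = D' := by
        rw [← map_add]; exact hD' _
      rw [← Comp.mk_add_right a b e u (d - 1) _ _ hD2 (hD' x) (hD' y)]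
      exact Comp.mk_congr a (by rw [map_add]) e _ _
    · have hv : ∀ z : B.obj (l t) d, Function.update (Function.update b t ⟨d, z⟩) u
          (β.homog (Function.update b t (⟨d, z⟩ : B.Homog (l t)) u)) =
          Function.update (Function.update b u (β.homog (b u))) t ⟨d, z⟩ := by
        intro z; rw [Function.update_of_ne hu, Function.update_comm (Ne.symm hu)]
      have hD' : ∀ z : B.obj (l t) d, i + ∑ s, (Function.update
          (Function.update b u (β.homog (b u))) t (⟨d, z⟩ : B.Homog (l t)) s).1 = D' := by
        intro z; rw [← hv]; exact Comp.deg_update hD β _ (hh _) u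
      rw [Comp.mk_congr a (hv (x + y)) e _ (hD' _), Comp.mk_congr a (hv x) e _ (hD' _),
        Comp.mk_congr a (hv y) e _ (hD' _)]
      exact Comp.mk_add_right a _ e t d x y _ _ _
  | @smul_right k i a l b e t d r x h hx =>
    simp only [map_smul, Finsupp.linearCombination_single, one_smul]
    have hh : ∀ z : B.obj (l t) d, i + ∑ s, (Function.update b t ⟨d, z⟩ s).1 = D := by
      intro z; rw [Comp.fst_update] at hx ⊢; exact hx
    have hdeg : ∀ z : B.obj (l t) d, (fun s => (Function.update b t (⟨d, z⟩ : B.Homog (l t)) s).1) =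
        Function.update (fun s => (b s).1) t d := fun z => Comp.fst_update b t ⟨d, z⟩
    have h1 : ∀ z : B.obj (l t) d, i - 1 + ∑ s, (Function.update b t ⟨d, z⟩ s).1 = D' := by
      intro z; have := hh z; linarith
    rw [Comp.dGen_eq α β hD a _ e h _ (hdeg _) (h1 _) (fun u => Comp.deg_update hD β _ (hh _) u),
      Comp.dGen_eq α β hD a _ e hx _ (hdeg _) (h1 _) (fun u => Comp.deg_update hD β _ (hh _) u),
      Comp.mk_smul_right _ b e t d r x (h1 _) (h1 _), smul_add, Finset.smul_sum]
    congr 1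
    apply Finset.sum_congr rfl
    intro u _
    rw [← Comp.units_smul_comm]
    congr 1
    by_cases hu : u = t
    · subst hu
      have hv : ∀ z : B.obj (l u) d, Function.update (Function.update b u ⟨d, z⟩) u
          (β.homog (Function.update b u (⟨d, z⟩ : B.Homog (l u)) u)) =
          Function.update b u ⟨d - 1, β.map (l u) d (d - 1) (by ring) z⟩ := by
        intro z; rw [Function.update_idem, Function.update_self]; rfl
      have hD' : ∀ z : B.obj (l u) d, i + ∑ s, (Function.update b u
          (⟨d - 1, β.map (l u) d (d - 1) (by ring) z⟩ : B.Homog (l u)) s).1 = D' := by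
        intro z; rw [← hv]; exact Comp.deg_update hD β _ (hh _) u
      rw [Comp.mk_congr a (hv (r • x)) e _ (hD' _), Comp.mk_congr a (hv x) e _ (hD' _)]
      have hD2 : i + ∑ s, (Function.update b u
          (⟨d - 1, r • β.map (l u) d (d - 1) (by ring) x⟩ : B.Homog (l u)) s).1 = D' := by
        rw [← map_smul]; exact hD' _
      rw [← Comp.mk_smul_right a b e u (d - 1) _ _ hD2 (hD' x)]
      exact Comp.mk_congr a (by rw [map_smul]) e _ _
    · have hv : ∀ z : B.obj (l t) d, Function.update (Function.update b t ⟨d, z⟩) u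
          (β.homog (Function.update b t (⟨d, z⟩ : B.Homog (l t)) u)) =
          Function.update (Function.update b u (β.homog (b u))) t ⟨d, z⟩ := by
        intro z; rw [Function.update_of_ne hu, Function.update_comm (Ne.symm hu)]
      have hD' : ∀ z : B.obj (l t) d, i + ∑ s, (Function.update
          (Function.update b u (β.homog (b u))) t (⟨d, z⟩ : B.Homog (l t)) s).1 = D' := by
        intro z; rw [← hv]; exact Comp.deg_update hD β _ (hh _) u
      rw [Comp.mk_congr a (hv (r • x)) e _ (hD' _), Comp.mk_congr a (hv x) e _ (hD' _)]
      exact Comp.mk_smul_right a _ e t d r x _ _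
  | @act_right k i a l b e τ h h' =>
    simp only [Finsupp.linearCombination_single, one_smul, Comp.dGen]
    congr 1
    · exact Comp.mk_act_right _ b e τ _ _
    · apply Finset.sum_congr rfl
      intro t _
      have hv : Function.update (fun t => B.hact (τ t) (b t)) t (β.homog (B.hact (τ t) (b t))) =
          fun s => B.hact (τ s) (Function.update b t (β.homog (b t)) s) := by
        funext s
        rw [GrSym.DegEnd.homog_hact]
        exact (Function.apply_update (fun s => B.hact (τ s)) b t (β.homog (b t)) s).symm
      have hD' : i + ∑ s, (B.hact (τ s) (Function.update b t (β.homog (b t)) s)).1 = D' :=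
        Comp.deg_update hD β b h' t
      rw [Comp.mk_congr a hv e _ hD', Comp.mk_act_right a _ e τ _ (Comp.deg_update hD β b h' t)]
      rfl
  | @act_left k i a l b e σ h h' =>
    rw [Units.smul_def, map_zsmul, ← Units.smul_def]
    simp only [Finsupp.linearCombination_single, one_smul, Comp.dGen]
    rw [smul_add, Finset.smul_sum, ← Equiv.sum_comp σ]
    congr 1
    · rw [α.map_act]
      exact Comp.mk_act_left _ b e σ _ _
    · apply Finset.sum_congr rfl
      intro u _
      have hv : (fun s => Function.update b (σ u) (β.homog (b (σ u))) (σ s)) =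
          Function.update (fun s => b (σ s)) u (β.homog (b (σ u))) :=
        Function.update_comp_eq_of_injective' b σ.injective u _
      have hD' : i + ∑ s, (Function.update b (σ u) (β.homog (b (σ u))) (σ s)).1 = D' := by
        have h2 := Comp.deg_update hD β b h (σ u)
        rw [← Equiv.sum_comp σ] at h2
        exact h2
      rw [Comp.mk_act_left a _ e σ _ hD', smul_smul, smul_smul, Comp.fst_update]
      have hs := koszulSign_prefixSign σ i (fun s => (b s).1) u
      have hb : (β.homog (b (σ u))).1 = (b (σ u)).1 - 1 := rfl
      rw [hb, hs]
      congr 1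
      exact Comp.mk_congr a hv _ _ _

/-- The homomorphism of degree `-1` of `A ∘ B` induced by homomorphisms of degree `-1` of `A` and
of `B`, given on generators by `Comp.dGen`. -/
def GrSym.DegEnd.comp {K : Type u} [CommRing K] {A B : GrSym K} (α : A.DegEnd) (β : B.DegEnd) :
    (A.comp B).DegEnd where
  map _ _ _ hD := Comp.lift (Comp.dGen α β hD) (Comp.dGen_rel α β hD)
  map_act n D D' hD σ x := by
    have key : (Comp.lift (Comp.dGen α β hD) (Comp.dGen_rel α β hD)).comp (Comp.actMap A B n D σ) =
        (Comp.actMap A B n D' σ).comp (Comp.lift (Comp.dGen α β hD) (Comp.dGen_rel α β hD)) := by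
      apply Comp.hom_ext
      intro g
      simp only [LinearMap.comp_apply, Comp.lift_gen, Comp.actMap]
      simp only [Comp.dGen, map_add, map_sum, Comp.lift_gen, Units.smul_def, map_zsmul]
      rfl
    exact LinearMap.congr_fun key x

/-- A dg `Σ_*`-module (`Σ_*`-object in `ℤ`-graded chain complexes of `K`-modules): a graded
`Σ_*`-module with an equivariant differential of degree `-1`. -/
structure DGSym (K : Type u) [CommRing K] extends GrSym K where
  d : toGrSym.DegEnd
  d_d : ∀ (n : ℕ) (i j k : ℤ) (h : j + 1 = i) (h' : k + 1 = j) (x : obj n i),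
    d.map n j k h' (d.map n i j h x) = 0

theorem Comp.dGen_dGen {K : Type u} [CommRing K] (A B : DGSym K) {n : ℕ} {D D' D'' : ℤ}
    (hD : D' + 1 = D) (hD' : D'' + 1 = D') (g : Comp.Gen A.toGrSym B.toGrSym n D) :
    Comp.lift (Comp.dGen A.d B.d hD') (Comp.dGen_rel A.d B.d hD') (Comp.dGen A.d B.d hD g) = 0 := by
  obtain ⟨a, b, e, h⟩ := g
  rename_i k i l
  have hdg : ∀ t, i + ∑ s, (Function.update b t (B.d.homog (b t)) s).1 = D' :=
    Comp.deg_update hD B.d b h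
  have hdg' : ∀ t, i - 1 + ∑ s, (Function.update b t (B.d.homog (b t)) s).1 = D'' := by
    intro t; have := hdg t; linarith
  have hb1 : i - 1 + ∑ t, (b t).1 = D' := by linarith
  have hb2 : i - 1 - 1 + ∑ t, (b t).1 = D'' := by linarith
  rw [Comp.dGen]
  simp only [map_add, map_sum, Units.smul_def, map_zsmul, Comp.lift_gen]
  simp only [← Units.smul_def]
  rw [Comp.dGen_eq A.d B.d hD' _ b e hb1 _ rfl hb2 hdg']
  have hz : Comp.mk (A.d.map k (i - 1) (i - 1 - 1) (by ring) (A.d.map k i (i - 1) (by ring) a))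
      b e hb2 = 0 := by
    rw [A.d_d]; exact Comp.mk_zero_left b e hb2
  rw [hz, zero_add]
  have hdd : ∀ t u, i + ∑ s, (Function.update (Function.update b t (B.d.homog (b t))) u
      (B.d.homog (Function.update b t (B.d.homog (b t)) u)) s).1 = D'' :=
    fun t => Comp.deg_update hD' B.d _ (hdg t)
  have hterm : ∀ t, Comp.dGen A.d B.d hD' ⟨a, Function.update b t (B.d.homog (b t)), e, hdg t⟩ =
      Comp.mk (A.d.map k i (i - 1) (by ring) a) (Function.update b t (B.d.homog (b t))) e (hdg' t) +
        ∑ u, prefixSign i (Function.update (fun s => (b s).1) t ((b t).1 - 1)) u •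
          Comp.mk a (Function.update (Function.update b t (B.d.homog (b t))) u
            (B.d.homog (Function.update b t (B.d.homog (b t)) u))) e (hdd t u) :=
    fun t => Comp.dGen_eq A.d B.d hD' a _ e (hdg t) _ (Comp.fst_update b t _) (hdg' t) (hdd t)
  simp_rw [hterm, smul_add, Finset.sum_add_distrib]
  rw [← add_assoc, ← Finset.sum_add_distrib]
  have hfirst : ∀ t, prefixSign (i - 1) (fun s => (b s).1) t = - prefixSign i (fun s => (b s).1) t := by
    intro t
    rw [prefixSign, prefixSign, sub_add_eq_add_sub, Int.negOnePow_sub]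
    simp
  have hf : ∀ t, prefixSign (i - 1) (fun s => (b s).1) t •
        Comp.mk (A.d.map k i (i - 1) (by ring) a) (Function.update b t (B.d.homog (b t))) e (hdg' t) +
      prefixSign i (fun s => (b s).1) t •
        Comp.mk (A.d.map k i (i - 1) (by ring) a) (Function.update b t (B.d.homog (b t))) e (hdg' t)
      = 0 := by
    intro t
    rw [hfirst, Units.smul_def, Units.smul_def, Units.val_neg, neg_smul, neg_add_cancel]
  rw [Finset.sum_congr rfl (fun t _ => hf t), Finset.sum_const_zero, zero_add]
  simp_rw [Finset.smul_sum, smul_smul]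
  rw [← Finset.sum_product']
  set F : Fin k × Fin k → Comp.Obj A.toGrSym B.toGrSym n D'' := fun p =>
    (prefixSign i (fun s => (b s).1) p.1 *
      prefixSign i (Function.update (fun s => (b s).1) p.1 ((b p.1).1 - 1)) p.2) •
      Comp.mk a (Function.update (Function.update b p.1 (B.d.homog (b p.1))) p.2
            (B.d.homog (Function.update b p.1 (B.d.homog (b p.1)) p.2))) e (hdd p.1 p.2) with hF
  have hdiag : ∀ t, F (t, t) = 0 := by
    intro t
    simp only [hF]
    have hv : Function.update (Function.update b t (B.d.homog (b t))) t
            (B.d.homog (Function.update b t (B.d.homog (b t)) t)) =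
        Function.update b t ⟨(b t).1 - 1 - 1, 0⟩ := by
      rw [Function.update_idem, Function.update_self]
      exact congrArg (fun z => Function.update b t (⟨(b t).1 - 1 - 1, z⟩ : B.Homog (l t)))
        (B.d_d (l t) (b t).1 ((b t).1 - 1) ((b t).1 - 1 - 1) (by ring) (by ring) (b t).2)
    have h0 : i + ∑ s, (Function.update b t (⟨(b t).1 - 1 - 1, 0⟩ : B.Homog (l t)) s).1 = D'' := by
      rw [← hv]; exact hdd t t
    rw [Comp.mk_congr a hv e _ h0, Comp.mk_zero_right, smul_zero]
  have hanti : ∀ t u, t < u → F (t, u) + F (u, t) = 0 := by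
    intro t u htu
    simp only [hF]
    have hv : Function.update (Function.update b t (B.d.homog (b t))) u
            (B.d.homog (Function.update b t (B.d.homog (b t)) u)) =
        Function.update (Function.update b u (B.d.homog (b u))) t
            (B.d.homog (Function.update b u (B.d.homog (b u)) t)) := by
      rw [Function.update_of_ne htu.ne', Function.update_of_ne htu.ne,
        Function.update_comm htu.ne]
    rw [Comp.mk_congr a hv e _ (hdd u t), prefixSign_update_of_lt i (fun s => (b s).1) htu,
      prefixSign_update_of_le i (fun s => (b s).1) htu.le, mul_neg, Units.smul_def,
      Units.smul_def, Units.val_neg, neg_smul, mul_comm, neg_add_cancel]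
  refine Finset.sum_involution (fun p _ => (p.2, p.1)) ?_ ?_ ?_ ?_
  · rintro ⟨t, u⟩ _
    rcases lt_trichotomy t u with htu | rfl | htu
    · exact hanti t u htu
    · change F (t, t) + F (t, t) = 0
      rw [hdiag, add_zero]
    · rw [add_comm]; exact hanti u t htu
  · rintro ⟨t, u⟩ _ hne heq
    simp only [Prod.mk.injEq] at heq
    obtain ⟨rfl, _⟩ := heq
    exact hne (hdiag _)
  · simp
  · simp

/-- The composition product `A ∘ B` of dg `Σ_*`-modules. -/
abbrev DGSym.comp {K : Type u} [CommRing K] (A B : DGSym K) : DGSym K where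
  toGrSym := A.toGrSym.comp B.toGrSym
  d := A.d.comp B.d
  d_d n D D' D'' hD hD' x := by
    have key : (Comp.lift (Comp.dGen A.d B.d hD') (Comp.dGen_rel A.d B.d hD')).comp
        (Comp.lift (Comp.dGen A.d B.d (n := n) hD) (Comp.dGen_rel A.d B.d hD)) = 0 := by
      apply Comp.hom_ext
      intro g
      rw [LinearMap.comp_apply, Comp.lift_gen, Comp.dGen_dGen]; rfl
    exact LinearMap.congr_fun key x

/-- Morphisms of graded `Σ_*`-modules: equivariant linear maps of degree `0`. -/
structure GrHom {K : Type u} [CommRing K] (X Y : GrSym K) where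
  map : ∀ (n : ℕ) (i : ℤ), X.obj n i →ₗ[K] Y.obj n i
  map_act : ∀ (n : ℕ) (i : ℤ) (σ : Equiv.Perm (Fin n)) (x : X.obj n i),
    map n i (X.act n i σ x) = Y.act n i σ (map n i x)

/-- The identity morphism. -/
def GrHom.id {K : Type u} [CommRing K] (X : GrSym K) : GrHom X X where
  map _ _ := LinearMap.id
  map_act _ _ _ _ := rfl

/-- A morphism, applied to homogeneous elements. -/
def GrHom.homog {K : Type u} [CommRing K] {X Y : GrSym K} (f : GrHom X Y) {n : ℕ}
    (x : X.Homog n) : Y.Homog n :=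
  ⟨x.1, f.map n x.1 x.2⟩

/-- Morphisms of dg `Σ_*`-modules: morphisms commuting with the differentials. -/
structure DGHom {K : Type u} [CommRing K] (X Y : DGSym K) extends
    GrHom X.toGrSym Y.toGrSym where
  map_d : ∀ (n : ℕ) (i j : ℤ) (h : j + 1 = i) (x : X.obj n i),
    map n j (X.d.map n i j h x) = Y.d.map n i j h (map n i x)

/-! ### Associativity of composition products -/

/-- The Koszul sign of the reordering
`b_1, …, b_k, c_1, …, c_k ↦ b_1, c_1, b_2, c_2, …, b_k, c_k`. -/
def assocSign {k : ℕ} (b c : Fin k → ℤ) : ℤˣ :=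
  (∑ s, ∑ t, if s < t then c s * b t else 0).negOnePow

/-- The labelling of the inputs of `a(b_1(c_{11}, …), …, b_k(c_{k1}, …))` induced by a labelling
of the inputs of `a(b_1, …, b_k)(c_{11}, …)`. -/
def assocLabel {k n : ℕ} (l : Fin k → ℕ) (r : Fin (∑ t, l t) → ℕ)
    (e : (Σ u, Fin (r u)) ≃ Fin n) :
    (Σ t : Fin k, Fin (∑ s : Fin (l t), r (finSigmaFinEquiv ⟨t, s⟩))) ≃ Fin n :=
  (Equiv.sigmaCongrRight fun t =>
      (finSigmaFinEquiv (n := fun s : Fin (l t) => r (finSigmaFinEquiv ⟨t, s⟩))).symm).trans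
    ((Equiv.sigmaAssoc fun (t : Fin k) (s : Fin (l t)) =>
        Fin (r (finSigmaFinEquiv ⟨t, s⟩))).symm.trans
      ((Equiv.sigmaCongrLeft (β := fun u => Fin (r u))
        (finSigmaFinEquiv (n := l))).trans e))

theorem assoc_degree {k : ℕ} {i D : ℤ} (l : Fin k → ℕ) (b : Fin k → ℤ)
    (c : Fin (∑ t, l t) → ℤ) (h : i + ∑ t, b t + ∑ u, c u = D) :
    i + ∑ t, (b t + ∑ s : Fin (l t), c (finSigmaFinEquiv ⟨t, s⟩)) = D := by
  rw [Finset.sum_add_distrib, ← add_assoc, ← h, ← Equiv.sum_comp finSigmaFinEquiv c,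
    Fintype.sum_sigma]

/-- The identity `g ∘ (f ∘ C) = k ∘ (A ∘ h)` of maps `(A ∘ B) ∘ C = A ∘ (B ∘ C) → Z`, written on
the generators: `g(f(a(b_1, …, b_k))(c_{11}, …)) = ± k(a(h(b_1(c_{11}, …)), …, h(b_k(c_{k1}, …))))`.
All associativity axioms below are of this form. -/
def IsAssoc {K : Type u} [CommRing K] {A B C X Y Z : GrSym K} (f : GrHom (A.comp B) X)
    (g : GrHom (X.comp C) Z) (h : GrHom (B.comp C) Y) (k : GrHom (A.comp Y) Z) : Prop :=
  ∀ (m : ℕ) (i : ℤ) (a : A.obj m i) (l : Fin m → ℕ) (b : ∀ t, B.Homog (l t))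
    (r : Fin (∑ t, l t) → ℕ) (c : ∀ u, C.Homog (r u)) (n : ℕ) (D : ℤ)
    (e : (Σ u, Fin (r u)) ≃ Fin n) (hD : i + ∑ t, (b t).1 + ∑ u, (c u).1 = D),
    g.map n D (Comp.mk (f.map _ _ (Comp.mk a b finSigmaFinEquiv rfl)) c e hD) =
      assocSign (fun t => (b t).1) (fun t => ∑ s : Fin (l t), (c (finSigmaFinEquiv ⟨t, s⟩)).1) •
        k.map n D (Comp.mk a
          (fun t => ⟨(b t).1 + ∑ s : Fin (l t), (c (finSigmaFinEquiv ⟨t, s⟩)).1,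
            h.map _ _ (Comp.mk (b t).2 (fun s => c (finSigmaFinEquiv ⟨t, s⟩))
              finSigmaFinEquiv rfl)⟩)
          (assocLabel l r e) (assoc_degree l (fun t => (b t).1) (fun u => (c u).1) hD))

/-! ### Operads and bimodules -/

/-- The element `η(x)` of `A ∘ X`, for `η ∈ A(1)` of degree `0`. -/
def Comp.unitLeft {K : Type u} [CommRing K] {A X : GrSym K} (η : A.obj 1 0) {n : ℕ} {i : ℤ}
    (x : X.obj n i) : (A.comp X).obj n i :=
  Comp.mk η (fun _ : Fin 1 => (⟨i, x⟩ : X.Homog n)) (Equiv.uniqueSigma fun _ => Fin n) (by simp)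

/-- The element `x(η, …, η)` of `X ∘ A`, for `η ∈ A(1)` of degree `0`. -/
def Comp.unitRight {K : Type u} [CommRing K] {A X : GrSym K} (η : A.obj 1 0) {n : ℕ} {i : ℤ}
    (x : X.obj n i) : (X.comp A).obj n i :=
  Comp.mk x (fun _ : Fin n => (⟨0, η⟩ : A.Homog 1)) (Equiv.sigmaUnique (Fin n) fun _ => Fin 1)
    (by simp)

/-- Operads in dg modules: a dg `Σ_*`-module `P` with a unit `1 ∈ P(1)` (a cycle of degree `0`)
and a composition product `P ∘ P → P`, associative and unital. -/
structure DGOperad (K : Type u) [CommRing K] extends DGSym K where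
  one : obj 1 0
  d_one : d.map 1 0 (-1) (by norm_num) one = 0
  mul : DGHom (toDGSym.comp toDGSym) toDGSym
  mul_assoc : IsAssoc mul.toGrHom mul.toGrHom mul.toGrHom mul.toGrHom
  one_mul : ∀ (n : ℕ) (i : ℤ) (x : obj n i), mul.map n i (Comp.unitLeft one x) = x
  mul_one : ∀ (n : ℕ) (i : ℤ) (x : obj n i), mul.map n i (Comp.unitRight one x) = x

/-- A `Σ_*`-module is connected if it vanishes in arity `0`. -/
def GrSym.Connected {K : Type u} [CommRing K] (X : GrSym K) : Prop :=
  ∀ d, Subsingleton (X.obj 0 d)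

/-- An operad is connected if `P(0) = 0` and `P(1) = K` (concentrated in degree `0`, via the
unit of `P`). -/
structure DGOperad.IsConnected {K : Type u} [CommRing K] (P : DGOperad K) : Prop where
  arity_zero : P.toGrSym.Connected
  arity_one : ∀ d, d ≠ 0 → Subsingleton (P.obj 1 d)
  bijective_one : Function.Bijective (fun r : K => r • P.one)

/-- The structure of a `P`-`Q`-bimodule on a dg `Σ_*`-module `X`: a left action `P ∘ X → X` and a
right action `X ∘ Q → X`, morphisms of dg `Σ_*`-modules, associative, unital and commuting with
each other. -/
structure BimoduleStr {K : Type u} [CommRing K] (P Q : DGOperad K) (X : DGSym K) where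
  lam : DGHom (P.toDGSym.comp X) X
  rho : DGHom (X.comp Q.toDGSym) X
  lam_assoc : IsAssoc P.mul.toGrHom lam.toGrHom lam.toGrHom lam.toGrHom
  rho_assoc : IsAssoc rho.toGrHom rho.toGrHom Q.mul.toGrHom rho.toGrHom
  lam_rho : IsAssoc lam.toGrHom rho.toGrHom rho.toGrHom lam.toGrHom
  one_lam : ∀ (n : ℕ) (i : ℤ) (x : X.obj n i), lam.map n i (Comp.unitLeft P.one x) = x
  rho_one : ∀ (n : ℕ) (i : ℤ) (x : X.obj n i), rho.map n i (Comp.unitRight Q.one x) = x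

/-- Morphisms of bimodules: morphisms of dg `Σ_*`-modules commuting with both actions. -/
structure IsBimoduleHom {K : Type u} [CommRing K] {P Q : DGOperad K} {X Y : DGSym K}
    (BX : BimoduleStr P Q X) (BY : BimoduleStr P Q Y) (f : DGHom X Y) : Prop where
  map_lam : ∀ {k : ℕ} {i : ℤ} (p : P.obj k i) {l : Fin k → ℕ} (x : ∀ t, X.Homog (l t))
    (n : ℕ) (D : ℤ) (e : (Σ t, Fin (l t)) ≃ Fin n) (h : i + ∑ t, (x t).1 = D),
    f.map n D (BX.lam.map n D (Comp.mk p x e h)) =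
      BY.lam.map n D (Comp.mk p (fun t => f.homog (x t)) e h)
  map_rho : ∀ {k : ℕ} {i : ℤ} (x : X.obj k i) {l : Fin k → ℕ} (q : ∀ t, Q.Homog (l t))
    (n : ℕ) (D : ℤ) (e : (Σ t, Fin (l t)) ≃ Fin n) (h : i + ∑ t, (q t).1 = D),
    f.map n D (BX.rho.map n D (Comp.mk x q e h)) =
      BY.rho.map n D (Comp.mk (f.map k i x) q e h)

/-! ### Cofibrant objects -/

/-- Weak equivalences: in each arity, the map induced in homology is injective and surjective in
every degree. -/
structure DGHom.IsWeakEquiv {K : Type u} [CommRing K] {X Y : DGSym K} (p : DGHom X Y) : Prop where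
  homology_inj : ∀ (n : ℕ) (i : ℤ) (x : X.obj n i), X.d.map n i (i - 1) (by ring) x = 0 →
    (∃ y, Y.d.map n (i + 1) i rfl y = p.map n i x) → ∃ z, X.d.map n (i + 1) i rfl z = x
  homology_surj : ∀ (n : ℕ) (i : ℤ) (y : Y.obj n i), Y.d.map n i (i - 1) (by ring) y = 0 →
    ∃ x, X.d.map n i (i - 1) (by ring) x = 0 ∧
      ∃ z, Y.d.map n (i + 1) i rfl z = p.map n i x - y

/-- Fibrations: surjective in each arity and each degree. -/
def DGHom.IsFibration {K : Type u} [CommRing K] {X Y : DGSym K} (p : DGHom X Y) : Prop :=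
  ∀ n i, Function.Surjective (p.map n i)

/-- A dg `Σ_*`-module `M` is cofibrant if `0 → M` has the left lifting property with respect to
acyclic fibrations. -/
def DGSym.IsCofibrant {K : Type u} [CommRing K] (M : DGSym K) : Prop :=
  ∀ (X Y : DGSym K) (p : DGHom X Y), p.IsFibration → p.IsWeakEquiv →
    ∀ f : DGHom M Y, ∃ g : DGHom M X, ∀ n i (x : M.obj n i), p.map n i (g.map n i x) = f.map n i x

/-- A `P`-`Q`-bimodule `N` is cofibrant if `0 → N` has the left lifting property with respect to
acyclic fibrations of connected `P`-`Q`-bimodules. -/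
def BimoduleStr.IsCofibrant {K : Type u} [CommRing K] {P Q : DGOperad K} {N : DGSym K}
    (BN : BimoduleStr P Q N) : Prop :=
  ∀ (X Y : DGSym K) (BX : BimoduleStr P Q X) (BY : BimoduleStr P Q Y),
    X.toGrSym.Connected → Y.toGrSym.Connected →
    ∀ p : DGHom X Y, IsBimoduleHom BX BY p → p.IsFibration → p.IsWeakEquiv →
    ∀ f : DGHom N Y, IsBimoduleHom BN BY f →
      ∃ g : DGHom N X, IsBimoduleHom BN BX g ∧
        ∀ n i (x : N.obj n i), p.map n i (g.map n i x) = f.map n i x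

/-! ### Twisted objects and quasi-free bimodules -/

/-- Twisting homomorphisms: `δ ∂ + ∂ δ + ∂² = 0`. -/
def DGSym.IsTwisting {K : Type u} [CommRing K] (X : DGSym K) (tw : X.toGrSym.DegEnd) : Prop :=
  ∀ (n : ℕ) (i j k : ℤ) (h : j + 1 = i) (h' : k + 1 = j) (x : X.obj n i),
    X.d.map n j k h' (tw.map n i j h x) + tw.map n j k h' (X.d.map n i j h x) +
      tw.map n j k h' (tw.map n i j h x) = 0

/-- The twisted object `(X, ∂)`: the graded object `X` with the differential `δ + ∂`. -/
abbrev DGSym.twist {K : Type u} [CommRing K] (X : DGSym K) (tw : X.toGrSym.DegEnd)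
    (htw : X.IsTwisting tw) : DGSym K where
  toGrSym := X.toGrSym
  d :=
    { map := fun n i j h => X.d.map n i j h + tw.map n i j h
      map_act := by
        intro n i j h σ x
        simp only [LinearMap.add_apply, map_add, X.d.map_act, tw.map_act] }
  d_d n i j k h h' x := by
    have := htw n i j k h h' x
    simp only [LinearMap.add_apply, map_add, X.d_d, zero_add]
    rw [← this]
    abel

/-- The dg `Σ_*`-module `P ∘ M ∘ Q`. -/
abbrev freeObj {K : Type u} [CommRing K] (P : DGOperad K) (M : DGSym K) (Q : DGOperad K) :
    DGSym K :=
  P.toDGSym.comp (M.comp Q.toDGSym)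

/-- Quasi-free `P`-`Q`-bimodules `(P ∘ M ∘ Q, ∂)`: a twisting homomorphism `∂` of `P ∘ M ∘ Q` such
that the twisted object `(P ∘ M ∘ Q, ∂)` is a `P`-`Q`-bimodule for the actions of the free
bimodule `P ∘ M ∘ Q`.  The fields `lam_free` and `rho_free` say that the actions are those of the
free bimodule: the left action is induced by the composition product `P ∘ P → P`, through
`P ∘ (P ∘ N) = (P ∘ P) ∘ N` with `N = M ∘ Q`; the right action is induced by the right action
`R` of `Q` on `N`, through `(P ∘ N) ∘ Q = P ∘ (N ∘ Q)`; and `R` is induced by the composition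
product `Q ∘ Q → Q`, through `(M ∘ Q) ∘ Q = M ∘ (Q ∘ Q)`.  These formulas determine the actions,
because they give their values on generators. -/
structure QuasiFreeBimodule {K : Type u} [CommRing K] (P : DGOperad K) (M : DGSym K)
    (Q : DGOperad K) where
  tw : (freeObj P M Q).toGrSym.DegEnd
  isTwisting : (freeObj P M Q).IsTwisting tw
  str : BimoduleStr P Q ((freeObj P M Q).twist tw isTwisting)
  lam_free : IsAssoc P.mul.toGrHom (GrHom.id (freeObj P M Q).toGrSym)
    (GrHom.id (freeObj P M Q).toGrSym) str.lam.toGrHom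
  rho_free : ∃ R : GrHom ((M.comp Q.toDGSym).toGrSym.comp Q.toGrSym) (M.comp Q.toDGSym).toGrSym,
    IsAssoc (GrHom.id (M.comp Q.toDGSym).toGrSym) R Q.mul.toGrHom
      (GrHom.id (M.comp Q.toDGSym).toGrSym) ∧
    IsAssoc (GrHom.id (freeObj P M Q).toGrSym) str.rho.toGrHom R
      (GrHom.id (freeObj P M Q).toGrSym)

/-- The inclusion `M ⊂ P ∘ M ∘ Q`, `m ↦ 1(m(1, …, 1))`. -/
def freeIncl {K : Type u} [CommRing K] (P : DGOperad K) (M : DGSym K) (Q : DGOperad K) {n : ℕ}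
    {i : ℤ} (m : M.obj n i) : (freeObj P M Q).obj n i :=
  Comp.unitLeft P.one (Comp.unitRight Q.one m)

/-- The submodule `P̄ ∘ M ∘ Q` of `P ∘ M ∘ Q`, spanned by the composites `p(z_1, …, z_k)` with `p` of
arity `k > 1`. -/
def decompLeft {K : Type u} [CommRing K] (P : DGOperad K) (M : DGSym K) (Q : DGOperad K) (n : ℕ)
    (D : ℤ) : Submodule K ((freeObj P M Q).obj n D) :=
  Submodule.span K {w | ∃ (k : ℕ) (i : ℤ) (p : P.obj k i) (l : Fin k → ℕ)
    (z : ∀ t, (M.comp Q.toDGSym).Homog (l t)) (e : (Σ t, Fin (l t)) ≃ Fin n)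
    (h : i + ∑ t, (z t).1 = D), 1 < k ∧ w = Comp.mk p z e h}

/-- The submodule `P ∘ M ∘ Q̄` of `P ∘ M ∘ Q`, spanned by the composites
`p(m_1(q_{11}, …), …, m_k(q_{k1}, …))` in which some `q_{ts}` has arity `> 1`. -/
def decompRight {K : Type u} [CommRing K] (P : DGOperad K) (M : DGSym K) (Q : DGOperad K) (n : ℕ)
    (D : ℤ) : Submodule K ((freeObj P M Q).obj n D) :=
  Submodule.span K {w | ∃ (k : ℕ) (i : ℤ) (p : P.obj k i) (l : Fin k → ℕ)
    (v : Fin k → ℕ) (m : ∀ t, M.Homog (v t)) (r : ∀ t, Fin (v t) → ℕ)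
    (q : ∀ t s, Q.Homog (r t s)) (f : ∀ t, (Σ s, Fin (r t s)) ≃ Fin (l t))
    (e : (Σ t, Fin (l t)) ≃ Fin n) (h : i + ∑ t, ((m t).1 + ∑ s, (q t s).1) = D),
    (∃ t s, 1 < r t s) ∧
      w = Comp.mk (B := (M.comp Q.toDGSym).toGrSym) p
        (fun t => ⟨(m t).1 + ∑ s, (q t s).1, Comp.mk (m t).2 (q t) (f t) rfl⟩) e h}

/-- The twisting differential is decomposable: `∂(M) ⊂ P̄ ∘ M ∘ Q + P ∘ M ∘ Q̄`. -/
def QuasiFreeBimodule.IsDecomposable {K : Type u} [CommRing K] {P : DGOperad K} {M : DGSym K}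
    {Q : DGOperad K} (N : QuasiFreeBimodule P M Q) : Prop :=
  ∀ (n : ℕ) (i j : ℤ) (h : j + 1 = i) (m : M.obj n i),
    N.tw.map n i j h (freeIncl P M Q m) ∈ decompLeft P M Q n j ⊔ decompRight P M Q n j

end

noncomputable section

variable {K : Type u} [CommRing K]

/-! ### Functoriality of the composition product -/

/-! As a graded bimodule, `P ∘ M ∘ Q` is free on `M`. A graded equivariant map `g : M → X` thus has
an extension `BX.extend g` compatible with both actions (`extend_lam`, `extend_rho`), and a bimodule
morphism out of `P ∘ M ∘ Q` is the extension of its restriction to `M` (`IsBimoduleHom.eq_extend`).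
A lift of `f` along `p` therefore amounts to a map `g` on `M` with `p g = f` and, on each generator
`m`, `d g(m) = g(dm) + ext_g(∂m)`. If these equations hold on `M`, the extension commutes with `δ +
∂` everywhere, because the actions are chain maps for the twisted differential
(`QuasiFreeBimodule.mem_commSubmodule`).

The equations look circular, since `ext_g(∂m)` involves `g`; decomposability makes them recursive in
the arity. As `M(0) = Q(0) = 0`, every nonzero `m(q_1, …)` has positive arity, at least that of `m`.
Hence if `m` has arity `n`, the decomposable element `∂m` is a combination of composites `p(m_1(…),
…, m_k(…))` in which all `m_t` have arity `< n` (`IsDecomposable.mem_spanArity`), and `ext_g(∂m)`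
depends only on `g` in arities `< n` (`extend_eq_of_arity`).

In arity `n`, with lower arities settled, `φ(m) = ext_g(∂m)` is thus a known map of degree `-1`. The
twisting equation gives `dφ = -φd`, and compatibility with `f` gives `d f(m) = f(dm) + pφ(m)`. It
remains to solve `p g = f`, `dg = gd + φ`. This inhomogeneous problem is an ordinary lifting
problem: `(f, φ)` is a chain map from `M` to the mapping cone of `p`, and a solution is the first
component of a lift through `cone(id_X) → cone(p)`. That map is surjective with the same kernel as
`p`, hence is an acyclic fibration, and cofibrancy of `M` supplies the lift
(`DGSym.IsCofibrant.exists_lift`). The solutions for successive arities are glued in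
`exists_partialLift_univ`. -/

theorem GrHom.map_units_smul {X Y : GrSym K} (f : GrHom X Y) {n : ℕ} {i : ℤ} (ε : ℤˣ)
    (x : X.obj n i) : f.map n i (ε • x) = ε • f.map n i x := by
  rw [Units.smul_def, map_zsmul, ← Units.smul_def]

theorem GrHom.homog_update {B B' : GrSym K} (β : GrHom B B') {k : ℕ} {l : Fin k → ℕ}
    (b : ∀ t, B.Homog (l t)) (t : Fin k) (x : B.Homog (l t)) :
    (fun s => β.homog (Function.update b t x s)) =
      Function.update (fun s => β.homog (b s)) t (β.homog x) := by
  funext s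
  exact Function.apply_update (fun _ => β.homog) b t x s

theorem GrHom.homog_hact {B B' : GrSym K} (β : GrHom B B') {n : ℕ} (τ : Equiv.Perm (Fin n))
    (x : B.Homog n) : β.homog (B.hact τ x) = B'.hact τ (β.homog x) := by
  obtain ⟨d, x⟩ := x
  exact congrArg (fun z => (⟨d, z⟩ : B'.Homog n)) (β.map_act n d τ x)

theorem GrHom.deg_homog {B B' : GrSym K} (β : GrHom B B') {k : ℕ} {i D : ℤ} {l : Fin k → ℕ}
    (b : ∀ t, B.Homog (l t)) (h : i + ∑ t, (b t).1 = D) : i + ∑ t, (β.homog (b t)).1 = D :=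
  h

theorem GrSym.deg_hact {B : GrSym K} {k : ℕ} {i D : ℤ} {l : Fin k → ℕ}
    (τ : ∀ t, Equiv.Perm (Fin (l t))) (b : ∀ t, B.Homog (l t)) (h : i + ∑ t, (b t).1 = D) :
    i + ∑ t, (B.hact (τ t) (b t)).1 = D :=
  h

/-- Composition of morphisms of graded `Σ_*`-modules. -/
def GrHom.trans {X Y Z : GrSym K} (f : GrHom X Y) (g : GrHom Y Z) : GrHom X Z where
  map n i := (g.map n i).comp (f.map n i)
  map_act n i σ x := by simp only [LinearMap.comp_apply, f.map_act, g.map_act]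

theorem Comp.map_rel {A B A' B' : GrSym K} (α : GrHom A A') (β : GrHom B B') {n : ℕ} {D : ℤ}
    (x y : Comp.Gen A B n D →₀ K) (h : Comp.Rel A B n D x y) :
    Finsupp.linearCombination K (fun g : Comp.Gen A B n D =>
        Comp.mk (α.map _ _ g.a) (fun t => β.homog (g.b t)) g.e (β.deg_homog g.b g.h)) x =
      Finsupp.linearCombination K (fun g : Comp.Gen A B n D =>
        Comp.mk (α.map _ _ g.a) (fun t => β.homog (g.b t)) g.e (β.deg_homog g.b g.h)) y := by
  cases h with
  | add_left a a' b e h =>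
    simp only [map_add, Finsupp.linearCombination_single, one_smul]
    exact Comp.mk_add_left _ _ (fun t => β.homog (b t)) e h
  | smul_left r a b e h =>
    simp only [map_smul, Finsupp.linearCombination_single, one_smul]
    exact Comp.mk_smul_left r _ (fun t => β.homog (b t)) e h
  | @add_right k i a l b e t d x y h hx hy =>
    simp only [map_add, Finsupp.linearCombination_single, one_smul]
    have hh : ∀ z : B'.obj (l t) d,
        i + ∑ s, (Function.update (fun s => β.homog (b s)) t ⟨d, z⟩ s).1 = D := by
      intro z
      rw [Comp.fst_update] at h ⊢
      exact h
    have hv : ∀ z : B.obj (l t) d, (fun s => β.homog (Function.update b t ⟨d, z⟩ s)) =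
        Function.update (fun s => β.homog (b s)) t ⟨d, β.map (l t) d z⟩ :=
      fun z => β.homog_update b t ⟨d, z⟩
    rw [Comp.mk_congr _ (hv _) e _ (hh _), Comp.mk_congr _ (hv x) e _ (hh _),
      Comp.mk_congr _ (hv y) e _ (hh _), ← Comp.mk_add_right]
    · exact Comp.mk_congr _ (by rw [map_add]) e _ _
    · exact hh _
  | @smul_right k i a l b e t d r x h hx =>
    simp only [map_smul, Finsupp.linearCombination_single, one_smul]
    have hh : ∀ z : B'.obj (l t) d,
        i + ∑ s, (Function.update (fun s => β.homog (b s)) t ⟨d, z⟩ s).1 = D := by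
      intro z
      rw [Comp.fst_update] at h ⊢
      exact h
    have hv : ∀ z : B.obj (l t) d, (fun s => β.homog (Function.update b t ⟨d, z⟩ s)) =
        Function.update (fun s => β.homog (b s)) t ⟨d, β.map (l t) d z⟩ :=
      fun z => β.homog_update b t ⟨d, z⟩
    rw [Comp.mk_congr _ (hv _) e _ (hh _), Comp.mk_congr _ (hv x) e _ (hh _),
      ← Comp.mk_smul_right]
    · exact Comp.mk_congr _ (by rw [map_smul]) e _ _
    · exact hh _
  | act_right a b e τ h h' =>
    simp only [Finsupp.linearCombination_single, one_smul]
    exact (Comp.mk_congr _ (by funext t; rw [GrHom.homog_hact]) e _ _).trans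
      (Comp.mk_act_right _ (fun t => β.homog (b t)) e τ h h')
  | act_left a b e σ h h' =>
    rw [Units.smul_def, map_zsmul, ← Units.smul_def]
    simp only [Finsupp.linearCombination_single, one_smul]
    rw [α.map_act]
    exact Comp.mk_act_left _ (fun t => β.homog (b t)) e σ h h'

/-- The morphism `α ∘ β : A ∘ B → A' ∘ B'`. -/
def GrHom.compMap {A B A' B' : GrSym K} (α : GrHom A A') (β : GrHom B B') :
    GrHom (A.comp B) (A'.comp B') where
  map _ _ := Comp.lift (fun g => Comp.mk (α.map _ _ g.a) (fun t => β.homog (g.b t)) g.e (β.deg_homog g.b g.h))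
    (Comp.map_rel α β)
  map_act n D σ x := by
    refine LinearMap.congr_fun (f := (Comp.lift _ (Comp.map_rel α β)).comp (Comp.actMap A B n D σ))
      (g := (Comp.actMap A' B' n D σ).comp (Comp.lift _ (Comp.map_rel α β)))
      (Comp.hom_ext fun g => ?_) x
    simp only [LinearMap.comp_apply, Comp.lift_gen, Comp.actMap]
    rfl

theorem GrHom.compMap_mk {A B A' B' : GrSym K} (α : GrHom A A') (β : GrHom B B') {n : ℕ} {D : ℤ}
    {k : ℕ} {i : ℤ} (a : A.obj k i) {l : Fin k → ℕ} (b : ∀ t, B.Homog (l t))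
    (e : (Σ t, Fin (l t)) ≃ Fin n) (h : i + ∑ t, (b t).1 = D) :
    (α.compMap β).map n D (Comp.mk a b e h) =
      Comp.mk (α.map k i a) (fun t => β.homog (b t)) e (β.deg_homog b h) :=
  Comp.lift_gen _ (Comp.map_rel α β) _

/-! ### Induction on generators -/

/-- The homogeneous elements of `A ∘ B` of the form `a(b_1, …, b_k)`. -/
def Comp.IsPure (A B : GrSym K) ⦃n : ℕ⦄ (x : (A.comp B).Homog n) : Prop :=
  ∃ (k : ℕ) (a : A.Homog k) (l : Fin k → ℕ) (b : ∀ t, B.Homog (l t)) (e : (Σ t, Fin (l t)) ≃ Fin n),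
    x = ⟨a.1 + ∑ t, (b t).1, Comp.mk a.2 b e rfl⟩

theorem Comp.mem_span_isPure {A B : GrSym K} {n : ℕ} {D : ℤ} (x : Comp.Obj A B n D) :
    x ∈ Submodule.span K {y : Comp.Obj A B n D | Comp.IsPure A B (n := n) ⟨D, y⟩} := by
  set S := Submodule.span K
    {y : Comp.Obj A B n D | Comp.IsPure A B (n := n) ⟨D, y⟩} with hS
  have : S.mkQ = 0 := Comp.hom_ext fun g => by
    simp only [Submodule.mkQ_apply, LinearMap.zero_apply, Submodule.Quotient.mk_eq_zero]
    obtain ⟨a, b, e, rfl⟩ := g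
    exact Submodule.subset_span ⟨_, ⟨_, a⟩, _, b, e, rfl⟩
  have hx := LinearMap.congr_fun this x
  simpa using hx

theorem Comp.mk_eq_zero_of_right {A B : GrSym K} {n : ℕ} {D : ℤ} {k : ℕ} {i : ℤ} (a : A.obj k i)
    {l : Fin k → ℕ} (b : ∀ t, B.Homog (l t)) (e : (Σ t, Fin (l t)) ≃ Fin n)
    (h : i + ∑ t, (b t).1 = D) (t : Fin k) (ht : (b t).2 = 0) : Comp.mk a b e h = 0 := by
  have hb : b = Function.update b t ⟨(b t).1, 0⟩ := by
    rw [← ht]; exact (Function.update_eq_self t b).symm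
  rw [Comp.mk_congr a hb e h (hb ▸ h), Comp.mk_zero_right]

/-- Multilinear induction: to show that `a(b_1, …, b_k)` lies in a submodule, we can assume that
the `b_t` belong to sets of elements that span them. -/
theorem Comp.mk_mem_of_span {A B : GrSym K} {n : ℕ} {D : ℤ} (S : Submodule K (Comp.Obj A B n D))
    (G : ∀ ⦃m : ℕ⦄, B.Homog m → Prop) {k : ℕ} {i : ℤ} (a : A.obj k i) {l : Fin k → ℕ}
    (e : (Σ t, Fin (l t)) ≃ Fin n)
    (H : ∀ (b : ∀ t, B.Homog (l t)) (h : i + ∑ t, (b t).1 = D), (∀ t, G (b t)) →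
      Comp.mk a b e h ∈ S)
    (b : ∀ t, B.Homog (l t)) (h : i + ∑ t, (b t).1 = D)
    (hb : ∀ t, (b t).2 ∈ Submodule.span K {x : B.obj (l t) (b t).1 | G (m := l t) ⟨(b t).1, x⟩}) :
    Comp.mk a b e h ∈ S := by
  -- `T` is the set of slots still known only to lie in the span of `G`; slots outside `T` already
  -- satisfy `G`. Linearity in one slot of `T` at a time reduces `T` to the empty set.
  suffices HT : ∀ (T : Finset (Fin k)) (b : ∀ t, B.Homog (l t)) (h : i + ∑ t, (b t).1 = D),
      (∀ t ∈ T, (b t).2 ∈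
        Submodule.span K {x : B.obj (l t) (b t).1 | G (m := l t) ⟨(b t).1, x⟩}) →
      (∀ t, t ∉ T → G (b t)) → Comp.mk a b e h ∈ S from
    HT Finset.univ b h (fun t _ => hb t) (fun t ht => absurd (Finset.mem_univ t) ht)
  intro T
  induction T using Finset.induction_on with
  | empty => exact fun b h _ hG => H b h fun t => hG t (Finset.notMem_empty t)
  | insert t T htT ih =>
    intro b h hsp hG
    have hh : ∀ z : B.obj (l t) (b t).1,
        i + ∑ s, (Function.update b t ⟨(b t).1, z⟩ s).1 = D := by
      intro z
      rw [Comp.fst_update, Function.update_eq_self]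
      exact h
    have key : ∀ x ∈ Submodule.span K {x : B.obj (l t) (b t).1 | G (m := l t) ⟨(b t).1, x⟩},
        Comp.mk a (Function.update b t ⟨(b t).1, x⟩) e (hh x) ∈ S := by
      intro x hx
      induction hx using Submodule.span_induction with
      | mem x hx =>
        apply ih
        · intro s hs
          have hst : s ≠ t := fun h => htT (h ▸ hs)
          rw [Function.update_of_ne hst]
          exact hsp s (Finset.mem_insert_of_mem hs)
        · intro s hs
          by_cases hst : s = t
          · subst hst
            rw [Function.update_self]
            exact hx
          · rw [Function.update_of_ne hst]
            exact hG s (by simp [hst, hs])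
      | zero => rw [Comp.mk_zero_right]; exact S.zero_mem
      | add x y _ _ hx hy =>
        rw [Comp.mk_add_right a b e t _ x y _ (hh x) (hh y)]
        exact S.add_mem hx hy
      | smul r x _ hx =>
        rw [Comp.mk_smul_right a b e t _ r x _ (hh x)]
        exact S.smul_mem r hx
    have hv : b = Function.update b t ⟨(b t).1, (b t).2⟩ := (Function.update_eq_self t b).symm
    rw [Comp.mk_congr a hv e h (hh _)]
    exact key _ (hsp t (Finset.mem_insert_self t T))

theorem eq_sum_of_sigma_equiv {k n : ℕ} {l : Fin k → ℕ} (e : (Σ t, Fin (l t)) ≃ Fin n) :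
    n = ∑ t, l t := by
  simpa using (Fintype.card_congr e).symm

/-- A family indexed by pairs is a family indexed by `Fin (∑ t, l t)`. -/
theorem forall_sigma_family {C : GrSym K} {k : ℕ} {l : Fin k → ℕ}
    {motive : ∀ r : (∀ t, Fin (l t) → ℕ), (∀ t s, C.Homog (r t s)) → Prop}
    (H : ∀ (r : Fin (∑ t, l t) → ℕ) (c : ∀ u, C.Homog (r u)),
      motive (fun t s => r (finSigmaFinEquiv ⟨t, s⟩)) (fun t s => c (finSigmaFinEquiv ⟨t, s⟩)))
    (r : ∀ t, Fin (l t) → ℕ) (c : ∀ t s, C.Homog (r t s)) : motive r c := by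
  -- Bundling each element with its arity turns the two dependent families into one, so that
  -- reindexing is a plain rewriting by an equality of functions.
  suffices Hy : ∀ y : (∀ t, Fin (l t) → Σ n, C.Homog n),
      motive (fun t s => (y t s).1) (fun t s => (y t s).2) from Hy fun t s => ⟨r t s, c t s⟩
  intro y
  have hy : y = fun t s => (fun u => y (finSigmaFinEquiv.symm u).1 (finSigmaFinEquiv.symm u).2)
      (finSigmaFinEquiv ⟨t, s⟩) := by
    funext t s
    beta_reduce
    rw [Equiv.symm_apply_apply]
  rw [hy]
  exact H (fun u => (y (finSigmaFinEquiv.symm u).1 (finSigmaFinEquiv.symm u).2).1)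
    fun u => (y (finSigmaFinEquiv.symm u).1 (finSigmaFinEquiv.symm u).2).2

/-- `assocLabel` composes `e` with a fixed bijection, hence loses no labelling. This lets generators
of `A ∘ (B ∘ C)` with any outer labelling be reached by associativity relations. -/
theorem assocLabel_surjective {k n : ℕ} (l : Fin k → ℕ) (r : Fin (∑ t, l t) → ℕ)
    (e' : (Σ t : Fin k, Fin (∑ s : Fin (l t), r (finSigmaFinEquiv ⟨t, s⟩))) ≃ Fin n) :
    ∃ e, assocLabel l r e = e' :=
  ⟨finSigmaFinEquiv.trans ((assocLabel l r finSigmaFinEquiv).symm.trans e'), by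
    change (assocLabel l r finSigmaFinEquiv).trans
      ((assocLabel l r finSigmaFinEquiv).symm.trans e') = e'
    rw [← Equiv.trans_assoc, Equiv.self_trans_symm, Equiv.refl_trans]⟩

theorem Comp.mk_congr_label {A B : GrSym K} {n : ℕ} {D : ℤ} {k : ℕ} {i : ℤ} (a : A.obj k i)
    {l : Fin k → ℕ} (b : ∀ t, B.Homog (l t)) {e e' : (Σ t, Fin (l t)) ≃ Fin n} (he : e = e')
    (h : i + ∑ t, (b t).1 = D) : Comp.mk a b e h = Comp.mk a b e' h := by
  rw [he]

/-- Linear maps on `A ∘ (B ∘ C)` that agree on the elements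
`a(b_1(c_{11}, …), …, b_k(c_{k1}, …))` are equal. -/
theorem Comp.hom_ext_right {A B C : GrSym K} {n : ℕ} {D : ℤ} {W : Type u} [AddCommGroup W]
    [Module K W] {φ ψ : Comp.Obj A (B.comp C) n D →ₗ[K] W}
    (H : ∀ (m : ℕ) (i : ℤ) (a : A.obj m i) (l : Fin m → ℕ) (b : ∀ t, B.Homog (l t))
      (r : Fin (∑ t, l t) → ℕ) (c : ∀ u, C.Homog (r u)) (e : (Σ u, Fin (r u)) ≃ Fin n)
      (hD : i + ∑ t, (b t).1 + ∑ u, (c u).1 = D) (z : Comp.Obj A (B.comp C) n D),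
      z = Comp.mk (B := B.comp C) a
        (fun t => ⟨(b t).1 + ∑ s : Fin (l t), (c (finSigmaFinEquiv ⟨t, s⟩)).1,
          Comp.mk (b t).2 (fun s => c (finSigmaFinEquiv ⟨t, s⟩)) finSigmaFinEquiv rfl⟩)
        (assocLabel l r e) (assoc_degree l (fun t => (b t).1) (fun u => (c u).1) hD) →
      φ z = ψ z) : φ = ψ := by
  apply Comp.hom_ext
  rintro ⟨a, z, e, h⟩
  rename_i m i w
  change Comp.mk a z e h ∈ LinearMap.eqLocus φ ψ
  refine Comp.mk_mem_of_span _ (Comp.IsPure B C) a e ?_ z h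
    (fun t => Comp.mem_span_isPure (z t).2)
  intro z h hz
  choose l b r c f hf using hz
  obtain rfl : w = fun t => ∑ s, r t s := funext fun t => eq_sum_of_sigma_equiv (f t)
  obtain rfl := funext hf
  -- `τ t` compares the labelling `f t` of the inner composite with the standard block labelling.
  -- The relation `Comp.mk_act_right` moves it into the outer labelling, so only block labellings
  -- remain inside.
  let τ : ∀ t, Equiv.Perm (Fin (∑ s, r t s)) := fun t => finSigmaFinEquiv.symm.trans (f t)
  let z : ∀ t, (B.comp C).Homog (∑ s, r t s) := fun t =>
    ⟨(b t).1 + ∑ s, (c t s).1, Comp.mk (b t).2 (c t) finSigmaFinEquiv rfl⟩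
  have hτ : (fun t => (⟨(b t).1 + ∑ s, (c t s).1, Comp.mk (b t).2 (c t) (f t) rfl⟩ :
      (B.comp C).Homog (∑ s, r t s))) = fun t => (B.comp C).hact (τ t) (z t) := by
    funext t
    simp only [GrSym.hact]
    congr 1
    change _ = Comp.actMap B C _ _ (τ t) (Comp.gen _)
    rw [Comp.actMap, Comp.lift_gen]
    refine Comp.mk_congr_label _ _ ?_ _
    apply Equiv.ext
    intro x
    simp [τ]
  rw [(Comp.mk_congr a hτ e h (GrSym.deg_hact τ z h)).trans (Comp.mk_act_right a z e τ _ h)]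
  generalize (Equiv.sigmaCongrRight τ).trans e = e'
  change i + ∑ t, ((b t).1 + ∑ s, (c t s).1) = D at h
  revert e'
  revert h
  refine forall_sigma_family (motive := fun r c => ∀ (h : i + ∑ t, ((b t).1 + ∑ s, (c t s).1) = D)
      (e' : (Σ t, Fin (∑ s, r t s)) ≃ Fin n), Comp.mk (B := B.comp C) a
      (fun t => ⟨(b t).1 + ∑ s, (c t s).1, Comp.mk (b t).2 (c t) finSigmaFinEquiv rfl⟩) e' h ∈
        LinearMap.eqLocus φ ψ) ?_ r c
  intro r c h e'
  obtain ⟨e, rfl⟩ := assocLabel_surjective l r e'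
  refine H m i a l b r c e ?_ _ rfl
  rw [← h, Finset.sum_add_distrib, ← Equiv.sum_comp finSigmaFinEquiv (fun u => (c u).1),
    Fintype.sum_sigma, add_assoc]

/-- Linear maps on `(A ∘ B) ∘ C` that agree on the elements `a(b_1, …, b_k)(c_{11}, …)` are
equal. -/
theorem Comp.hom_ext_left {A B C : GrSym K} {n : ℕ} {D : ℤ} {W : Type u} [AddCommGroup W]
    [Module K W] {φ ψ : Comp.Obj (A.comp B) C n D →ₗ[K] W}
    (H : ∀ (m : ℕ) (i : ℤ) (a : A.obj m i) (l : Fin m → ℕ) (b : ∀ t, B.Homog (l t))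
      (r : Fin (∑ t, l t) → ℕ) (c : ∀ u, C.Homog (r u)) (e : (Σ u, Fin (r u)) ≃ Fin n)
      (hD : i + ∑ t, (b t).1 + ∑ u, (c u).1 = D) (z : Comp.Obj (A.comp B) C n D),
      z = Comp.mk (A := A.comp B) (Comp.mk a b finSigmaFinEquiv rfl) c e hD → φ z = ψ z) :
    φ = ψ := by
  apply Comp.hom_ext
  rintro ⟨x, c, e, h⟩
  rename_i k i r
  change Comp.mk (A := A.comp B) x c e h ∈ LinearMap.eqLocus φ ψ
  have hx := Comp.mem_span_isPure x
  induction hx using Submodule.span_induction with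
  | zero => rw [Comp.mk_zero_left]; exact Submodule.zero_mem _
  | add x y _ _ hx hy => rw [Comp.mk_add_left]; exact Submodule.add_mem _ hx hy
  | smul a x _ hx => rw [Comp.mk_smul_left]; exact Submodule.smul_mem _ _ hx
  | mem x hx =>
    obtain ⟨m, ⟨j, a⟩, l, b, f, hx⟩ := hx
    obtain rfl := eq_sum_of_sigma_equiv f
    obtain rfl : i = j + ∑ t, (b t).1 := congrArg Sigma.fst hx
    obtain rfl := eq_of_heq (Sigma.mk.inj hx).2
    -- Changing the labelling of `a(b_1, …)` is acting by a permutation. `Comp.mk_act_left` passes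
    -- this permutation to the `c_u`, at the cost of a sign, which is harmless for membership in a
    -- submodule.
    have hf : Comp.mk a b f rfl = (A.comp B).act _ _ (finSigmaFinEquiv.symm.trans f)
        (Comp.mk a b finSigmaFinEquiv rfl) := by
      change _ = Comp.actMap A B _ _ _ (Comp.gen _)
      rw [Comp.actMap, Comp.lift_gen]
      refine Comp.mk_congr_label _ _ ?_ _
      apply Equiv.ext
      intro x
      simp
    have h' : j + ∑ t, (b t).1 + ∑ u, (c ((finSigmaFinEquiv.symm.trans f) u)).1 = D := by
      rw [Equiv.sum_comp (finSigmaFinEquiv.symm.trans f) fun u => (c u).1]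
      exact h
    rw [hf, Comp.mk_act_left _ _ _ _ _ h', Units.smul_def]
    exact Submodule.smul_of_tower_mem _ _ (H _ _ a l b _ _ _ _ _ rfl)

/-! ### Naturality of associativity relations -/

/-- When the middle map is the identity, `k` on `A ∘ (B ∘ C)` is determined by `f` and `g` through
the associativity relation. Compatibility of the vertical maps with `f` and `g` therefore forces
compatibility with `k`. This serves to handle the left action of a free bimodule. -/
theorem IsAssoc.natural_right {A B C X Z A' B' C' X' Y' Z' : GrSym K}
    {f : GrHom (A.comp B) X} {g : GrHom (X.comp C) Z} {k : GrHom (A.comp (B.comp C)) Z}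
    {f' : GrHom (A'.comp B') X'} {g' : GrHom (X'.comp C') Z'}
    {h' : GrHom (B'.comp C') Y'} {k' : GrHom (A'.comp Y') Z'}
    (H : IsAssoc f g (GrHom.id (B.comp C)) k)
    (H' : IsAssoc f' g' h' k') {α : GrHom A A'} {β : GrHom B B'} {γ : GrHom C C'}
    {ξ : GrHom X X'} {υ : GrHom (B.comp C) Y'} {ζ : GrHom Z Z'}
    (hξ : ∀ n D x, ξ.map n D (f.map n D x) = f'.map n D ((α.compMap β).map n D x))
    (hυ : ∀ n D x, υ.map n D x = h'.map n D ((β.compMap γ).map n D x))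
    (hζ : ∀ n D x, ζ.map n D (g.map n D x) = g'.map n D ((ξ.compMap γ).map n D x))
    (n : ℕ) (D : ℤ) (x : Comp.Obj A (B.comp C) n D) :
    ζ.map n D (k.map n D x) = k'.map n D ((α.compMap υ).map n D x) := by
  refine LinearMap.congr_fun (f := (ζ.map n D).comp (k.map n D))
    (g := (k'.map n D).comp ((α.compMap υ).map n D)) (Comp.hom_ext_right ?_) x
  rintro m i a l b r c e hD _ rfl
  have h1 := congrArg (ζ.map n D) (H m i a l b r c n D e hD)
  have h2 := H' m i (α.map m i a) l (fun t => β.homog (b t)) r (fun u => γ.homog (c u)) n D e hD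
  rw [hζ, GrHom.compMap_mk, hξ, GrHom.compMap_mk, GrHom.map_units_smul] at h1
  -- Morphisms of degree `0` preserve degrees, so the two associativity signs coincide and cancel.
  refine (smul_left_cancel _ (h1.symm.trans h2)).trans ?_
  rw [LinearMap.comp_apply, GrHom.compMap_mk]
  refine congrArg (k'.map n D) (Comp.mk_congr _ ?_ _ _ _)
  funext t
  refine congrArg (Sigma.mk _) ?_
  rw [hυ, GrHom.compMap_mk]
  rfl

/-- The mirror principle: with an identity as first map, `g` on `(A ∘ B) ∘ C` is determined by `h`
and `k`. It serves for the right action, first on `M ∘ Q` and then on `P ∘ (M ∘ Q)`. -/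
theorem IsAssoc.natural_left {A B C Y Z A' B' C' X' Y' Z' : GrSym K}
    {g : GrHom ((A.comp B).comp C) Z} {h : GrHom (B.comp C) Y}
    {k : GrHom (A.comp Y) Z} {f' : GrHom (A'.comp B') X'} {g' : GrHom (X'.comp C') Z'}
    {h' : GrHom (B'.comp C') Y'} {k' : GrHom (A'.comp Y') Z'}
    (H : IsAssoc (GrHom.id (A.comp B)) g h k)
    (H' : IsAssoc f' g' h' k') {α : GrHom A A'} {β : GrHom B B'} {γ : GrHom C C'}
    {ξ : GrHom (A.comp B) X'} {υ : GrHom Y Y'} {ζ : GrHom Z Z'}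
    (hξ : ∀ n D x, ξ.map n D x = f'.map n D ((α.compMap β).map n D x))
    (hυ : ∀ n D x, υ.map n D (h.map n D x) = h'.map n D ((β.compMap γ).map n D x))
    (hζ : ∀ n D x, ζ.map n D (k.map n D x) = k'.map n D ((α.compMap υ).map n D x))
    (n : ℕ) (D : ℤ) (x : Comp.Obj (A.comp B) C n D) :
    ζ.map n D (g.map n D x) = g'.map n D ((ξ.compMap γ).map n D x) := by
  refine LinearMap.congr_fun (f := (ζ.map n D).comp (g.map n D))
    (g := (g'.map n D).comp ((ξ.compMap γ).map n D)) (Comp.hom_ext_left ?_) x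
  rintro m i a l b r c e hD _ rfl
  have h1 := congrArg (ζ.map n D) (H m i a l b r c n D e hD)
  have h2 := H' m i (α.map m i a) l (fun t => β.homog (b t)) r (fun u => γ.homog (c u)) n D e hD
  rw [GrHom.map_units_smul, hζ, GrHom.compMap_mk] at h1
  refine (h1.trans (congrArg _ ?_)).trans (h2.symm.trans ?_)
  · refine congrArg (k'.map n D) (Comp.mk_congr _ ?_ _ _ _)
    funext t
    refine congrArg (Sigma.mk _) ?_
    rw [hυ, GrHom.compMap_mk]
    rfl
  · rw [LinearMap.comp_apply, GrHom.compMap_mk, hξ, GrHom.compMap_mk]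
    rfl

/-- Associativity relations for elements with arbitrary labellings. -/
theorem IsAssoc.map_mk {A B C X Y Z : GrSym K} {f : GrHom (A.comp B) X}
    {g : GrHom (X.comp C) Z} {h : GrHom (B.comp C) Y} {k : GrHom (A.comp Y) Z}
    (H : IsAssoc f g h k) {m n N : ℕ} {i D I : ℤ} (a : A.obj m i) {l : Fin m → ℕ}
    (b : ∀ t, B.Homog (l t)) (e₁ : (Σ t, Fin (l t)) ≃ Fin N)
    (he₁ : ∀ x, (e₁ x).val = (finSigmaFinEquiv x).val) (hI : i + ∑ t, (b t).1 = I)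
    {r : Fin N → ℕ} (c : ∀ u, C.Homog (r u)) (e : (Σ u, Fin (r u)) ≃ Fin n)
    (hD : I + ∑ u, (c u).1 = D) {w : Fin m → ℕ} {r' : ∀ t, Fin (l t) → ℕ}
    (c' : ∀ t s, C.Homog (r' t s))
    (hc : ∀ t s, (⟨r' t s, c' t s⟩ : Σ v, C.Homog v) = ⟨r (e₁ ⟨t, s⟩), c (e₁ ⟨t, s⟩)⟩)
    (e₂ : ∀ t, (Σ s, Fin (r' t s)) ≃ Fin (w t)) (e₃ : (Σ t, Fin (w t)) ≃ Fin n)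
    (he : ∀ t s (x : Fin (r' t s)) (y : Fin (r (e₁ ⟨t, s⟩))), x.val = y.val →
      e₃ ⟨t, e₂ t ⟨s, x⟩⟩ = e ⟨e₁ ⟨t, s⟩, y⟩)
    (hD' : i + ∑ t, ((b t).1 + ∑ s, (c' t s).1) = D) :
    g.map n D (Comp.mk (f.map N I (Comp.mk a b e₁ hI)) c e hD) =
      assocSign (fun t => (b t).1) (fun t => ∑ s, (c' t s).1) •
        k.map n D (Comp.mk a (fun t => ⟨(b t).1 + ∑ s, (c' t s).1,
          h.map _ _ (Comp.mk (b t).2 (c' t) (e₂ t) rfl)⟩) e₃ hD') := by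
  subst hI
  obtain rfl := eq_sum_of_sigma_equiv e₁
  obtain rfl : e₁ = finSigmaFinEquiv := Equiv.ext fun x => Fin.ext (he₁ x)
  obtain rfl : r' = fun t s => r (finSigmaFinEquiv ⟨t, s⟩) := by
    funext t s
    exact congrArg Sigma.fst (hc t s)
  obtain rfl : c' = fun t s => c (finSigmaFinEquiv ⟨t, s⟩) := by
    funext t s
    exact eq_of_heq (Sigma.mk.inj (hc t s)).2
  obtain rfl : w = fun t => ∑ s, r (finSigmaFinEquiv ⟨t, s⟩) :=
    funext fun t => eq_sum_of_sigma_equiv (e₂ t)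
  rw [H m i a l b r c n D e hD]
  congr 2
  let z : ∀ t, Y.Homog (∑ s, r (finSigmaFinEquiv ⟨t, s⟩)) := fun t =>
    ⟨(b t).1 + ∑ s : Fin (l t), (c (finSigmaFinEquiv ⟨t, s⟩)).1,
      h.map _ _ (Comp.mk (b t).2 (fun s => c (finSigmaFinEquiv ⟨t, s⟩)) finSigmaFinEquiv rfl)⟩
  -- Again the discrepancy with the block labelling is a permutation inside each slot; equivariance
  -- of `h` carries it out, and `he` says that it is absorbed by `e₃`.
  let τ : ∀ t, Equiv.Perm (Fin (∑ s, r (finSigmaFinEquiv ⟨t, s⟩))) :=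
    fun t => finSigmaFinEquiv.symm.trans (e₂ t)
  have hτ : (fun t => (⟨(b t).1 + ∑ s, (c (finSigmaFinEquiv ⟨t, s⟩)).1,
      h.map _ _ (Comp.mk (b t).2 (fun s => c (finSigmaFinEquiv ⟨t, s⟩)) (e₂ t) rfl)⟩ :
      Y.Homog (∑ s, r (finSigmaFinEquiv ⟨t, s⟩)))) = fun t => Y.hact (τ t) (z t) := by
    funext t
    refine congrArg (Sigma.mk _) ?_
    rw [← h.map_act]
    congr 1
    change _ = Comp.actMap B C _ _ (τ t) (Comp.gen _)
    rw [Comp.actMap, Comp.lift_gen]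
    refine Comp.mk_congr_label _ _ ?_ _
    apply Equiv.ext
    intro x
    simp [τ]
  rw [(Comp.mk_congr a hτ e₃ hD' (GrSym.deg_hact τ z hD')).trans
    (Comp.mk_act_right a z e₃ τ _ hD')]
  refine Comp.mk_congr_label a z (Equiv.ext ?_) hD'
  rintro ⟨t, x⟩
  obtain ⟨⟨s, x⟩, rfl⟩ := finSigmaFinEquiv.surjective x
  have := he t s x x rfl
  simp only [assocLabel, Equiv.trans_apply, Equiv.sigmaCongrRight_apply, τ,
    Equiv.symm_apply_apply]
  rw [this]
  rfl

/-! ### Units -/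

theorem uniqueSigma_apply_val {n : ℕ} (x : Σ _ : Fin 1, Fin n) :
    ((Equiv.uniqueSigma fun _ : Fin 1 => Fin n) x).val = x.2.val := by
  obtain ⟨t, x⟩ := x
  obtain rfl := Subsingleton.elim default t
  rfl

theorem uniqueSigma_val_eq {n : ℕ} (x : Σ _ : Fin 1, Fin n) :
    ((Equiv.uniqueSigma fun _ : Fin 1 => Fin n) x).val =
      (finSigmaFinEquiv (n := fun _ : Fin 1 => n) x).val := by
  rw [uniqueSigma_apply_val, finSigmaFinEquiv_apply]
  obtain ⟨t, x⟩ := x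
  obtain rfl := Subsingleton.elim 0 t
  simp

theorem sigmaUnique_val_eq {n : ℕ} (x : Σ _ : Fin n, Fin 1) :
    ((Equiv.sigmaUnique (Fin n) fun _ => Fin 1) x).val =
      (finSigmaFinEquiv (n := fun _ : Fin n => 1) x).val := by
  rw [finSigmaFinEquiv_apply]
  obtain ⟨t, x⟩ := x
  obtain rfl := Subsingleton.elim 0 x
  simp [Equiv.sigmaUnique]

theorem assocSign_zero_left {k : ℕ} (c : Fin k → ℤ) : assocSign (fun _ => 0) c = 1 := by
  simp [assocSign]

theorem assocSign_one (b c : Fin 1 → ℤ) : assocSign b c = 1 := by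
  simp [assocSign]

theorem koszulSign_zero {k : ℕ} (σ : Equiv.Perm (Fin k)) : koszulSign σ (fun _ => 0) = 1 := by
  simp [koszulSign]

theorem Comp.homog_mk_congr {A B : GrSym K} {n : ℕ} {D D' : ℤ} {k : ℕ} {i : ℤ} (a : A.obj k i)
    {l : Fin k → ℕ} {b b' : ∀ t, B.Homog (l t)} (hb : b = b') {e e' : (Σ t, Fin (l t)) ≃ Fin n}
    (he : e = e') (h : i + ∑ t, (b t).1 = D) (h' : i + ∑ t, (b' t).1 = D') :
    (⟨D, Comp.mk a b e h⟩ : (A.comp B).Homog n) = ⟨D', Comp.mk a b' e' h'⟩ := by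
  subst h hb he h'
  rfl

theorem GrHom.homog_eq {X Y : GrSym K} (f : GrHom X Y) {n : ℕ} {d d' : ℤ} {x : X.obj n d}
    {x' : X.obj n d'} (h : (⟨d, x⟩ : X.Homog n) = ⟨d', x'⟩) :
    (⟨d, f.map n d x⟩ : Y.Homog n) = ⟨d', f.map n d' x'⟩ :=
  congrArg f.homog h

/-- The morphism `X → A ∘ X`, `x ↦ η(x)`. -/
def GrHom.unitLeft {A : GrSym K} (η : A.obj 1 0) (X : GrSym K) : GrHom X (A.comp X) where
  map n i :=
    { toFun := Comp.unitLeft η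
      map_add' := fun x y => by
        have := Comp.mk_add_right (n := n) (D := i) η (fun _ : Fin 1 => (⟨i, 0⟩ : X.Homog n))
          (Equiv.uniqueSigma fun _ => Fin n) 0 i x y (by simp) (by simp) (by simp)
        refine (Comp.mk_congr _ ?_ _ _ _).trans (this.trans (congrArg₂ _
          (Comp.mk_congr _ ?_ _ _ _) (Comp.mk_congr _ ?_ _ _ _))) <;>
        · funext t
          obtain rfl := Subsingleton.elim 0 t
          simp
      map_smul' := fun r x => by
        have := Comp.mk_smul_right (n := n) (D := i) η (fun _ : Fin 1 => (⟨i, 0⟩ : X.Homog n))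
          (Equiv.uniqueSigma fun _ => Fin n) 0 i r x (by simp) (by simp)
        refine (Comp.mk_congr _ ?_ _ _ _).trans (this.trans (congrArg _
          (Comp.mk_congr _ ?_ _ _ _))) <;>
        · funext t
          obtain rfl := Subsingleton.elim 0 t
          simp }
  map_act n i σ x := by
    refine (Comp.mk_act_right (n := n) (D := i) η (fun _ : Fin 1 => (⟨i, x⟩ : X.Homog n))
      (Equiv.uniqueSigma fun _ => Fin n) (fun _ => σ) (by simp [GrSym.hact]) (by simp)).trans ?_
    change _ = Comp.actMap A X n i σ (Comp.gen _)
    rw [Comp.actMap, Comp.lift_gen]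
    refine Comp.mk_congr_label _ _ (Equiv.ext ?_) _
    rintro ⟨t, y⟩
    obtain rfl := Subsingleton.elim default t
    rfl

/-- The morphism `X → X ∘ A`, `x ↦ x(η, …, η)`. -/
def GrHom.unitRight {A : GrSym K} (η : A.obj 1 0) (X : GrSym K) : GrHom X (X.comp A) where
  map n i :=
    { toFun := Comp.unitRight η
      map_add' := fun x y => Comp.mk_add_left x y _ _ _
      map_smul' := fun r x => Comp.mk_smul_left r x _ _ _ }
  map_act n i σ x := by
    refine (Comp.mk_act_left (n := n) (D := i) x (fun _ : Fin n => (⟨0, η⟩ : A.Homog 1))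
      (Equiv.sigmaUnique (Fin n) fun _ => Fin 1) σ (by simp) (by simp)).trans ?_
    change _ = Comp.actMap X A n i σ (Comp.gen _)
    rw [Comp.actMap, Comp.lift_gen, koszulSign_zero, one_smul]
    refine Comp.mk_congr_label _ _ (Equiv.ext ?_) _
    rintro ⟨t, y⟩
    rfl

/-- The case `b_t = η` of associativity: `a(η, …, η)(c_1, …) = a(η(c_1), …)`. No sign appears
because `η` has degree `0`. -/
theorem IsAssoc.map_unitRight {A B C X Y Z : GrSym K} {f : GrHom (A.comp B) X}
    {g : GrHom (X.comp C) Z} {h : GrHom (B.comp C) Y} {k : GrHom (A.comp Y) Z}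
    (H : IsAssoc f g h k) (η : B.obj 1 0) {m n : ℕ} {i D : ℤ} (a : A.obj m i) {r : Fin m → ℕ}
    (c : ∀ t, C.Homog (r t)) (e : (Σ t, Fin (r t)) ≃ Fin n) (hD : i + ∑ t, (c t).1 = D) :
    g.map n D (Comp.mk (f.map m i (Comp.unitRight η a)) c e hD) =
      k.map n D (Comp.mk a (fun t => h.homog ((GrHom.unitLeft η C).homog (c t))) e
        (h.deg_homog _ ((GrHom.unitLeft η C).deg_homog c hD))) := by
  have := H.map_mk a (fun _ : Fin m => (⟨0, η⟩ : B.Homog 1))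
    (Equiv.sigmaUnique (Fin m) fun _ => Fin 1) sigmaUnique_val_eq (by simp) c e hD
    (fun t (_ : Fin 1) => c t) (fun t s => rfl) (fun t => Equiv.uniqueSigma fun _ => Fin (r t)) e
    (fun t s x y hxy => congrArg e (congrArg (Sigma.mk t) (Fin.ext
      ((uniqueSigma_apply_val _).trans hxy)))) (by simpa using hD)
  rw [assocSign_zero_left, one_smul] at this
  refine this.trans (congrArg (k.map n D) (Comp.mk_congr _ ?_ _ _ _))
  funext t
  exact h.homog_eq (Comp.homog_mk_congr η rfl rfl _ _)

/-- The case `a = η` of associativity: `(η(b))(c_1, …) = η(b(c_1, …))`. No sign appears because a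
single `b` stands to the left of all the `c_t`. -/
theorem IsAssoc.map_unitLeft {A B C X Y Z : GrSym K} {f : GrHom (A.comp B) X}
    {g : GrHom (X.comp C) Z} {h : GrHom (B.comp C) Y} {k : GrHom (A.comp Y) Z}
    (H : IsAssoc f g h k) (η : A.obj 1 0) {m n : ℕ} {i D : ℤ} (b : B.obj m i) {r : Fin m → ℕ}
    (c : ∀ t, C.Homog (r t)) (e : (Σ t, Fin (r t)) ≃ Fin n) (hD : i + ∑ t, (c t).1 = D) :
    g.map n D (Comp.mk (f.map m i (Comp.unitLeft η b)) c e hD) =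
      k.map n D (Comp.unitLeft η (h.map n D (Comp.mk b c e hD))) := by
  have := H.map_mk η (fun _ : Fin 1 => (⟨i, b⟩ : B.Homog m))
    (Equiv.uniqueSigma fun _ => Fin m) uniqueSigma_val_eq (by simp) c e hD (w := fun _ => n)
    (fun (_ : Fin 1) s => c s) (fun t s => by
      obtain rfl := Subsingleton.elim default t
      rfl) (fun _ => e) (Equiv.uniqueSigma fun _ => Fin n)
    (fun t s x y hxy => by
      obtain rfl := Subsingleton.elim default t
      exact congrArg e (congrArg (Sigma.mk s) (Fin.ext hxy))) (by simpa using hD)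
  rw [assocSign_one] at this
  refine this.trans ((one_smul ℤˣ _).trans ?_)
  refine congrArg (k.map n D) (Comp.mk_congr _ ?_ _ _ _)
  funext t
  exact h.homog_eq (Comp.homog_mk_congr b rfl rfl _ _)

/-! ### Extension of morphisms to free bimodules -/

/-- The morphism `M ∘ Q → X` that extends a morphism `g : M → X` into a right `Q`-module. -/
def BimoduleStr.extendRight {P Q : DGOperad K} {X : DGSym K} (BX : BimoduleStr P Q X)
    {M : GrSym K} (g : GrHom M X.toGrSym) : GrHom (M.comp Q.toGrSym) X.toGrSym :=
  (g.compMap (GrHom.id Q.toGrSym)).trans BX.rho.toGrHom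

/-- The morphism `P ∘ M ∘ Q → X` that extends a morphism `g : M → X` into a bimodule. -/
def BimoduleStr.extend {P Q : DGOperad K} {X : DGSym K} (BX : BimoduleStr P Q X)
    {M : GrSym K} (g : GrHom M X.toGrSym) :
    GrHom (P.toGrSym.comp (M.comp Q.toGrSym)) X.toGrSym :=
  ((GrHom.id P.toGrSym).compMap (BX.extendRight g)).trans BX.lam.toGrHom

theorem BimoduleStr.extendRight_mk {P Q : DGOperad K} {X : DGSym K} (BX : BimoduleStr P Q X)
    {M : GrSym K} (g : GrHom M X.toGrSym) {k n : ℕ} {i D : ℤ} (m : M.obj k i) {l : Fin k → ℕ}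
    (q : ∀ t, Q.Homog (l t)) (e : (Σ t, Fin (l t)) ≃ Fin n) (h : i + ∑ t, (q t).1 = D) :
    (BX.extendRight g).map n D (Comp.mk m q e h) =
      BX.rho.map n D (Comp.mk (g.map k i m) q e h) :=
  congrArg (BX.rho.map n D) (GrHom.compMap_mk _ _ m q e h)

theorem BimoduleStr.extend_mk {P Q : DGOperad K} {X : DGSym K} (BX : BimoduleStr P Q X)
    {M : GrSym K} (g : GrHom M X.toGrSym) {k n : ℕ} {i D : ℤ} (p : P.obj k i) {l : Fin k → ℕ}
    (z : ∀ t, (M.comp Q.toGrSym).Homog (l t)) (e : (Σ t, Fin (l t)) ≃ Fin n)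
    (h : i + ∑ t, (z t).1 = D) :
    (BX.extend g).map n D (Comp.mk p z e h) =
      BX.lam.map n D (Comp.mk p (fun t => (BX.extendRight g).homog (z t)) e
        (GrHom.deg_homog _ z h)) :=
  congrArg (BX.lam.map n D) (GrHom.compMap_mk _ _ p z e h)

theorem BimoduleStr.extend_freeIncl {P Q : DGOperad K} {X : DGSym K} (BX : BimoduleStr P Q X)
    {M : GrSym K} (g : GrHom M X.toGrSym) {n : ℕ} {i : ℤ} (m : M.obj n i) :
    (BX.extend g).map n i (Comp.unitLeft P.one (Comp.unitRight Q.one m)) = g.map n i m := by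
  refine (BX.extend_mk g _ _ _ _).trans (Eq.trans ?_ (BX.one_lam n i (g.map n i m)))
  refine congrArg (BX.lam.map n i) (Comp.mk_congr _ ?_ _ _ _)
  funext t
  refine congrArg (Sigma.mk i) ?_
  exact (BX.extendRight_mk g _ _ _ _).trans (BX.rho_one n i (g.map n i m))

/-- The left action on `P ∘ (M ∘ Q)` comes from the product of `P`, so this is naturality of
associativity between `lam_free` and the associativity of the action on `X`. Differentials play no
role. -/
theorem QuasiFreeBimodule.extend_lam {P Q : DGOperad K} {M X : DGSym K}
    (N : QuasiFreeBimodule P M Q) (BX : BimoduleStr P Q X) (g : GrHom M.toGrSym X.toGrSym)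
    (n : ℕ) (D : ℤ) (x : Comp.Obj P.toGrSym (freeObj P M Q).toGrSym n D) :
    (BX.extend g).map n D (N.str.lam.map n D x) =
      BX.lam.map n D (((GrHom.id P.toGrSym).compMap (BX.extend g)).map n D x) := by
  refine N.lam_free.natural_right BX.lam_assoc (α := GrHom.id _) (β := GrHom.id _)
    (γ := BX.extendRight g) (ξ := GrHom.id _) ?_ ?_ ?_ n D x
  · intro n D x
    refine congrArg (P.mul.map n D) ?_
    -- The map `id ∘ id` is the identity, checked on generators.
    exact LinearMap.congr_fun (f := LinearMap.id) (Comp.hom_ext fun g =>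
      (GrHom.compMap_mk (GrHom.id _) (GrHom.id _) g.a g.b g.e g.h).symm) x
  · intro n D x
    rfl
  · intro n D x
    rfl

/-- Two layers: compatibility of `BX.extendRight g` with the action `R` on `M ∘ Q` follows from
associativity of the right action on `X`; putting `P` in front then uses the commutation of the two
actions on `X`. -/
theorem QuasiFreeBimodule.extend_rho {P Q : DGOperad K} {M X : DGSym K}
    (N : QuasiFreeBimodule P M Q) (BX : BimoduleStr P Q X) (g : GrHom M.toGrSym X.toGrSym)
    (n : ℕ) (D : ℤ) (x : Comp.Obj (freeObj P M Q).toGrSym Q.toGrSym n D) :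
    (BX.extend g).map n D (N.str.rho.map n D x) =
      BX.rho.map n D (((BX.extend g).compMap (GrHom.id Q.toGrSym)).map n D x) := by
  obtain ⟨R, hR, hN⟩ := N.rho_free
  refine hN.natural_left BX.lam_rho (α := GrHom.id _) (β := BX.extendRight g) (γ := GrHom.id _)
    (υ := BX.extendRight g) (fun n D x => rfl) ?_ (fun n D x => rfl) n D x
  refine hR.natural_left BX.rho_assoc (α := g) (β := GrHom.id _) (γ := GrHom.id _)
    (υ := GrHom.id _) (fun n D x => rfl) ?_ (fun n D x => rfl)
  intro n D x
  refine congrArg (Q.mul.map n D) ?_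
  exact LinearMap.congr_fun (f := LinearMap.id) (Comp.hom_ext fun g =>
    (GrHom.compMap_mk (GrHom.id _) (GrHom.id _) g.a g.b g.e g.h).symm) x

/-- The left action of the free bimodule on the generators `p(1(z_1), …, 1(z_k))`. -/
theorem QuasiFreeBimodule.lam_mk_unitLeft {P Q : DGOperad K} {M : DGSym K}
    (N : QuasiFreeBimodule P M Q) {k n : ℕ} {i D : ℤ} (p : P.obj k i) {l : Fin k → ℕ}
    (z : ∀ t, (M.comp Q.toDGSym).Homog (l t)) (e : (Σ t, Fin (l t)) ≃ Fin n)
    (h : i + ∑ t, (z t).1 = D) :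
    N.str.lam.map n D (Comp.mk p (fun t => (GrHom.unitLeft P.one _).homog (z t)) e
      ((GrHom.unitLeft P.one _).deg_homog z h)) =
      Comp.mk p z e h := by
  have h1 := N.lam_free.map_unitRight P.one p z e h
  rw [P.mul_one] at h1
  exact h1.symm

/-- The right action of the free bimodule on the generators `m(q_1, …, q_k)`. -/
theorem QuasiFreeBimodule.rho_mk_freeIncl {P Q : DGOperad K} {M : DGSym K}
    (N : QuasiFreeBimodule P M Q) {k n : ℕ} {i D : ℤ} (m : M.obj k i) {l : Fin k → ℕ}
    (q : ∀ t, Q.Homog (l t)) (e : (Σ t, Fin (l t)) ≃ Fin n) (h : i + ∑ t, (q t).1 = D) :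
    N.str.rho.map n D (Comp.mk (A := (freeObj P M Q).toGrSym) (freeIncl P M Q m) q e h) =
      Comp.unitLeft P.one (Comp.mk m q e h) := by
  obtain ⟨R, hR, hN⟩ := N.rho_free
  refine (hN.map_unitLeft P.one (Comp.unitRight Q.one m) q e h).trans ?_
  refine congrArg (Comp.unitLeft P.one) ((hR.map_unitRight Q.one m q e h).trans ?_)
  refine Comp.mk_congr _ ?_ _ _ _
  funext t
  exact congrArg (Sigma.mk _) (Q.one_mul _ _ (q t).2)

/-- The restriction to `M` of a morphism `P ∘ M ∘ Q → Y`. -/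
def GrHom.restrictFree {P : DGOperad K} {M : DGSym K} {Q : DGOperad K} {Y : GrSym K}
    (f : GrHom (freeObj P M Q).toGrSym Y) : GrHom M.toGrSym Y :=
  (GrHom.unitRight Q.one M.toGrSym).trans ((GrHom.unitLeft P.one (M.comp Q.toDGSym).toGrSym).trans f)

/-- A morphism of bimodules on `P ∘ M ∘ Q` is determined by its restriction to `M`. -/
theorem IsBimoduleHom.eq_extend {P Q : DGOperad K} {M Y : DGSym K} {N : QuasiFreeBimodule P M Q}
    {BY : BimoduleStr P Q Y}
    {f : DGHom ((freeObj P M Q).twist N.tw N.isTwisting) Y} (hf : IsBimoduleHom N.str BY f)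
    {n : ℕ} {D : ℤ} (x : (freeObj P M Q).obj n D) :
    f.map n D x = (BY.extend (GrHom.restrictFree f.toGrHom)).map n D x := by
  have h1 : ∀ n D (z : (M.comp Q.toDGSym).obj n D), f.map n D (Comp.unitLeft P.one z) =
      (BY.extendRight (GrHom.restrictFree f.toGrHom)).map n D z := by
    intro n D z
    refine LinearMap.congr_fun
      (f := (f.map n D).comp ((GrHom.unitLeft P.one (M.comp Q.toDGSym).toGrSym).map n D))
      (Comp.hom_ext ?_) z
    rintro ⟨m, q, e, h⟩
    refine Eq.trans ?_ (BY.extendRight_mk _ m q e h).symm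
    refine Eq.trans (congrArg (f.map n D) (N.rho_mk_freeIncl m q e h).symm) ?_
    exact hf.map_rho _ q n D e h
  refine LinearMap.congr_fun (Comp.hom_ext ?_) x
  rintro ⟨p, z, e, h⟩
  refine Eq.trans ?_ (BY.extend_mk _ p z e h).symm
  refine Eq.trans (congrArg (f.map n D) (N.lam_mk_unitLeft p z e h).symm) ?_
  refine (hf.map_lam p _ n D e _).trans (congrArg (BY.lam.map n D) (Comp.mk_congr _ ?_ _ _ _))
  funext t
  exact congrArg (Sigma.mk _) (h1 _ _ (z t).2)

/-- Composition of the extension of a morphism with a morphism of bimodules. -/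
theorem IsBimoduleHom.map_extend {P Q : DGOperad K} {M X Y : DGSym K}
    {BX : BimoduleStr P Q X} {BY : BimoduleStr P Q Y} {p : DGHom X Y} (hp : IsBimoduleHom BX BY p)
    (g : GrHom M.toGrSym X.toGrSym) {n : ℕ} {D : ℤ} (x : (freeObj P M Q).obj n D) :
    p.map n D ((BX.extend g).map n D x) = (BY.extend (g.trans p.toGrHom)).map n D x := by
  have h1 : ∀ n D (z : (M.comp Q.toDGSym).obj n D), p.map n D ((BX.extendRight g).map n D z) =
      (BY.extendRight (g.trans p.toGrHom)).map n D z := by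
    intro n D z
    refine LinearMap.congr_fun (f := (p.map n D).comp ((BX.extendRight g).map n D))
      (Comp.hom_ext ?_) z
    rintro ⟨m, q, e, h⟩
    refine Eq.trans ?_ (BY.extendRight_mk _ m q e h).symm
    refine Eq.trans (congrArg (p.map n D) (BX.extendRight_mk g m q e h)) ?_
    exact hp.map_rho _ q n D e h
  refine LinearMap.congr_fun (f := (p.map n D).comp ((BX.extend g).map n D)) (Comp.hom_ext ?_) x
  rintro ⟨a, z, e, h⟩
  refine Eq.trans ?_ (BY.extend_mk _ a z e h).symm
  refine Eq.trans (congrArg (p.map n D) (BX.extend_mk g a z e h)) ?_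
  refine (hp.map_lam a _ n D e _).trans (congrArg (BY.lam.map n D) (Comp.mk_congr _ ?_ _ _ _))
  funext t
  exact congrArg (Sigma.mk _) (h1 _ _ (z t).2)

/-! ### Commutation with differentials -/

/-- The elements on which a morphism of graded `Σ_*`-modules commutes with the differentials. -/
def GrHom.commSubmodule {X Y : DGSym K} (φ : GrHom X.toGrSym Y.toGrSym) (n : ℕ) (i : ℤ) :
    Submodule K (X.obj n i) :=
  LinearMap.eqLocus ((Y.d.map n i (i - 1) (by ring)).comp (φ.map n i))
    ((φ.map n (i - 1)).comp (X.d.map n i (i - 1) (by ring)))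

theorem GrHom.mem_commSubmodule {X Y : DGSym K} {φ : GrHom X.toGrSym Y.toGrSym} {n : ℕ} {i : ℤ}
    {x : X.obj n i} : x ∈ φ.commSubmodule n i ↔
      ∀ j (h : j + 1 = i), Y.d.map n i j h (φ.map n i x) = φ.map n j (X.d.map n i j h x) := by
  constructor
  · intro hx j h
    obtain rfl : j = i - 1 := by linarith
    exact hx
  · intro hx
    exact hx (i - 1) (by ring)

/-- By the Leibniz formula, each term differentiates a single factor, so it is enough that `α` and
`β` commute with the differentials at the factors of this particular generator. The pointwise form
matters: in the induction, commutation is known in low arities only. -/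
theorem Comp.compMap_d {A B A' B' : DGSym K} (α : GrHom A.toGrSym A'.toGrSym)
    (β : GrHom B.toGrSym B'.toGrSym) {n k : ℕ} {i D D' : ℤ} (hD : D' + 1 = D) {a : A.obj k i}
    {l : Fin k → ℕ} {b : ∀ t, B.Homog (l t)} (e : (Σ t, Fin (l t)) ≃ Fin n)
    (h : i + ∑ t, (b t).1 = D) (ha : a ∈ α.commSubmodule k i)
    (hb : ∀ t, (b t).2 ∈ β.commSubmodule (l t) (b t).1) :
    (A'.comp B').d.map n D D' hD ((α.compMap β).map n D (Comp.mk a b e h)) =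
      (α.compMap β).map n D' ((A.comp B).d.map n D D' hD (Comp.mk a b e h)) := by
  rw [GrHom.compMap_mk]
  refine (Comp.lift_gen _ (Comp.dGen_rel A'.d B'.d hD) _).trans ?_
  refine Eq.trans ?_ (congrArg ((α.compMap β).map n D')
    (Comp.lift_gen _ (Comp.dGen_rel A.d B.d hD) _).symm)
  have hl : ∀ t, (⟨(b t).1 - 1, B'.d.map (l t) (b t).1 ((b t).1 - 1) (by ring)
      (β.map (l t) (b t).1 (b t).2)⟩ : B'.Homog (l t)) = β.homog (B.d.homog (b t)) :=
    fun t => congrArg (Sigma.mk _) (hb t)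
  simp only [Comp.dGen, map_add, map_sum]
  refine congrArg₂ _ ?_ (Finset.sum_congr rfl fun t _ => ?_)
  · refine Eq.trans ?_ (GrHom.compMap_mk α β _ b e (by linarith)).symm
    rw [← show _ = α.map k (i - 1) _ from ha]
    rfl
  · refine Eq.trans ?_ (GrHom.map_units_smul (α.compMap β) _ _).symm
    refine congrArg (prefixSign i (fun s => (b s).1) t • ·) (Eq.trans ?_ (GrHom.compMap_mk α β a _ e (Comp.deg_update hD B.d b h t)).symm)
    refine Comp.mk_congr _ ?_ _ _ _
    rw [GrHom.homog_update, ← hl]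
    rfl

theorem GrHom.map_mk_mem_commSubmodule {A B Z A' B' Z' : DGSym K} {μ : DGHom (A.comp B) Z}
    {μ' : DGHom (A'.comp B') Z'} {α : GrHom A.toGrSym A'.toGrSym}
    {β : GrHom B.toGrSym B'.toGrSym} {ζ : GrHom Z.toGrSym Z'.toGrSym}
    (hμ : ∀ n D x, ζ.map n D (μ.map n D x) = μ'.map n D ((α.compMap β).map n D x))
    {n k : ℕ} {i D : ℤ} {a : A.obj k i} {l : Fin k → ℕ} {b : ∀ t, B.Homog (l t)}
    (e : (Σ t, Fin (l t)) ≃ Fin n) (h : i + ∑ t, (b t).1 = D) (ha : a ∈ α.commSubmodule k i)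
    (hb : ∀ t, (b t).2 ∈ β.commSubmodule (l t) (b t).1) :
    μ.map n D (Comp.mk a b e h) ∈ ζ.commSubmodule n D := by
  rw [GrHom.mem_commSubmodule]
  intro D' hD
  rw [hμ, ← μ'.map_d, Comp.compMap_d α β hD e h ha hb, ← hμ, μ.map_d]

theorem GrHom.mem_commSubmodule_id {X : DGSym K} {n : ℕ} {i : ℤ} (x : X.obj n i) :
    x ∈ (GrHom.id X.toGrSym).commSubmodule (X := X) (Y := X) n i :=
  rfl

/-! ### Decomposable elements -/

/-- The elements `m(q_1, …, q_k)` of `M ∘ Q` in which the arity of `m` belongs to `S`. -/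
def IsPureOfArity (M Q : GrSym K) (S : Set ℕ) ⦃n : ℕ⦄ (x : (M.comp Q).Homog n) : Prop :=
  ∃ (v : ℕ) (m : M.Homog v) (r : Fin v → ℕ) (q : ∀ t, Q.Homog (r t))
    (e : (Σ t, Fin (r t)) ≃ Fin n), v ∈ S ∧ x = ⟨m.1 + ∑ t, (q t).1, Comp.mk m.2 q e rfl⟩

/-- The submodule of `P ∘ M ∘ Q` spanned by the composites `p(m_1(q_{11}, …), …, m_k(q_{k1}, …))`
in which the arities of the `m_t` belong to `S`. -/
def spanArity (P M Q : GrSym K) (S : Set ℕ) (n : ℕ) (D : ℤ) : Submodule K (Comp.Obj P (M.comp Q) n D) :=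
  Submodule.span K {w | ∃ (k : ℕ) (i : ℤ) (p : P.obj k i) (l : Fin k → ℕ)
    (z : ∀ t, (M.comp Q).Homog (l t)) (e : (Σ t, Fin (l t)) ≃ Fin n)
    (h : i + ∑ t, (z t).1 = D), (∀ t, IsPureOfArity M Q S (z t)) ∧ w = Comp.mk p z e h}

/-- A nonzero composite has no factor of arity `0`, so `n` is a sum of `v` positive integers, and `n
> v` as soon as one of them exceeds `1`. -/
theorem Comp.eq_zero_or_arity_le {M Q : GrSym K} (hM : M.Connected) (hQ : Q.Connected) {v n : ℕ}
    {i D : ℤ} (m : M.obj v i) {r : Fin v → ℕ} (q : ∀ t, Q.Homog (r t))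
    (e : (Σ t, Fin (r t)) ≃ Fin n) (h : i + ∑ t, (q t).1 = D) :
    Comp.mk m q e h = 0 ∨ 1 ≤ v ∧ v ≤ n ∧ ∀ t, 1 < r t → v < n := by
  by_cases hr : ∃ t, r t = 0
  · obtain ⟨t, ht⟩ := hr
    left
    refine Comp.mk_eq_zero_of_right m q e h t ?_
    have : ∀ a, a = 0 → ∀ x : Q.Homog a, x.2 = 0 := by
      rintro _ rfl x
      exact (hQ x.1).elim _ _
    exact this _ ht _
  have hr' : ∀ t, 1 ≤ r t := fun t => Nat.one_le_iff_ne_zero.mpr fun h => hr ⟨t, h⟩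
  by_cases hv : v = 0
  · subst hv
    left
    rw [(hM i).elim m 0, Comp.mk_zero_left]
  right
  have hn := eq_sum_of_sigma_equiv e
  have hle : ∑ _t : Fin v, 1 ≤ ∑ t, r t := Finset.sum_le_sum fun t _ => hr' t
  refine ⟨Nat.one_le_iff_ne_zero.mpr hv, by simpa [hn] using hle, fun t ht => ?_⟩
  have hlt : ∑ _t : Fin v, 1 < ∑ t, r t :=
    Finset.sum_lt_sum (fun t _ => hr' t) ⟨t, Finset.mem_univ t, ht⟩
  simpa [hn] using hlt

theorem Comp.subsingleton_zero {M Q : GrSym K} (hM : M.Connected) (hQ : Q.Connected) {D : ℤ}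
    (x : Comp.Obj M Q 0 D) : x = 0 := by
  have : (LinearMap.id : Comp.Obj M Q 0 D →ₗ[K] _) = 0 := Comp.hom_ext fun g => by
    rcases Comp.eq_zero_or_arity_le hM hQ g.a g.b g.e g.h with h | ⟨h1, h2, _⟩
    · exact h
    · omega
  exact LinearMap.congr_fun this x

theorem add_le_sum_of_ne {k : ℕ} (l : Fin k → ℕ) {s t : Fin k} (h : s ≠ t) :
    l s + l t ≤ ∑ t, l t := by
  rw [← Finset.sum_pair h]
  exact Finset.sum_le_sum_of_subset (Finset.subset_univ _)

/-- At least two slots of positive arity share the `n` inputs, so each slot, and a fortiori each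
`m_t`, has arity `< n`. -/
theorem decompLeft_le_spanArity (P : DGOperad K) {M : DGSym K} {Q : DGOperad K}
    (hM : M.toGrSym.Connected) (hQ : Q.toGrSym.Connected) (n : ℕ) (D : ℤ) :
    decompLeft P M Q n D ≤ spanArity P.toGrSym M.toGrSym Q.toGrSym (Set.Iio n) n D := by
  refine Submodule.span_le.mpr ?_
  rintro _ ⟨k, i, p, l, z, e, h, hk, rfl⟩
  by_cases hl : ∃ t, l t = 0
  · obtain ⟨t, ht⟩ := hl
    have h0 : ∀ a, a = 0 → ∀ x : (M.comp Q.toDGSym).Homog a, x.2 = 0 := by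
      rintro _ rfl x
      -- A slot of arity `0` kills the composite, because `M ∘ Q` vanishes in arity `0`.
      exact Comp.subsingleton_zero hM hQ x.2
    rw [Comp.mk_eq_zero_of_right p z e h t (h0 _ ht _)]
    exact Submodule.zero_mem _
  have hl' : ∀ t, 1 ≤ l t := fun t => Nat.one_le_iff_ne_zero.mpr fun h => hl ⟨t, h⟩
  have hlt : ∀ t, l t < n := by
    intro t
    have : Nontrivial (Fin k) := Fin.nontrivial_iff_two_le.mpr hk
    obtain ⟨s, hs⟩ := exists_ne t
    have h1 := add_le_sum_of_ne l hs
    have h2 := eq_sum_of_sigma_equiv e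
    have h3 := hl' s
    omega
  refine Comp.mk_mem_of_span _ (Comp.IsPure M.toGrSym Q.toGrSym) p e ?_ z h
    fun t => Comp.mem_span_isPure (z t).2
  intro z h hz
  by_cases hz0 : ∃ t, (z t).2 = 0
  · obtain ⟨t, ht⟩ := hz0
    rw [Comp.mk_eq_zero_of_right p z e h t ht]
    exact Submodule.zero_mem _
  refine Submodule.subset_span ⟨k, i, p, l, z, e, h, fun t => ?_, rfl⟩
  obtain ⟨v, m, r, q, f, hq⟩ := hz t
  rcases Comp.eq_zero_or_arity_le hM hQ m.2 q f rfl with h0 | ⟨_, hv, _⟩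
  · refine absurd ⟨t, ?_⟩ hz0
    rw [hq]
    exact h0
  · exact ⟨v, m, r, q, f, hv.trans_lt (hlt t), hq⟩

/-- In the slot `t₀` that contains some `q` of arity `> 1`, the arity drops strictly from the slot
to `m_{t₀}`. Any other slot has arity `< n` because the slot `t₀` uses at least one input. -/
theorem decompRight_le_spanArity (P : DGOperad K) {M : DGSym K} {Q : DGOperad K}
    (hM : M.toGrSym.Connected) (hQ : Q.toGrSym.Connected) (n : ℕ) (D : ℤ) :
    decompRight P M Q n D ≤ spanArity P.toGrSym M.toGrSym Q.toGrSym (Set.Iio n) n D := by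
  refine Submodule.span_le.mpr ?_
  rintro _ ⟨k, i, p, l, v, m, r, q, f, e, h, ⟨t₀, s₀, hts⟩, rfl⟩
  by_cases hz0 : ∃ t, Comp.mk (m t).2 (q t) (f t) rfl = 0
  · obtain ⟨t, ht⟩ := hz0
    rw [Comp.mk_eq_zero_of_right p _ e h t ht]
    exact Submodule.zero_mem _
  have hv : ∀ t, 1 ≤ v t ∧ v t ≤ l t ∧ ∀ s, 1 < r t s → v t < l t := fun t =>
    (Comp.eq_zero_or_arity_le hM hQ (m t).2 (q t) (f t) rfl).resolve_left fun h => hz0 ⟨t, h⟩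
  refine Submodule.subset_span ⟨k, i, p, l, _, e, h, fun t => ?_, rfl⟩
  refine ⟨v t, m t, r t, q t, f t, ?_, rfl⟩
  change v t < n
  have h2 := eq_sum_of_sigma_equiv e
  have h3 := (hv t₀).2.2 s₀ hts
  by_cases htt : t = t₀
  · subst htt
    have h4 : l t ≤ ∑ t, l t := Finset.single_le_sum (fun _ _ => Nat.zero_le _) (Finset.mem_univ t)
    omega
  · have h4 := add_le_sum_of_ne l htt
    have h5 := hv t
    omega

theorem QuasiFreeBimodule.IsDecomposable.mem_spanArity {P Q : DGOperad K} {M : DGSym K}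
    {N : QuasiFreeBimodule P M Q} (hN : N.IsDecomposable) (hM : M.toGrSym.Connected)
    (hQ : Q.toGrSym.Connected) {n : ℕ} {i j : ℤ} (h : j + 1 = i) (m : M.obj n i) :
    N.tw.map n i j h (freeIncl P M Q m) ∈ spanArity P.toGrSym M.toGrSym Q.toGrSym (Set.Iio n) n j :=
  sup_le (decompLeft_le_spanArity P hM hQ n j) (decompRight_le_spanArity P hM hQ n j)
    (hN n i j h m)

/-- The extension evaluates `g` on the factors `m_t` and on nothing else. With `S` the arities `<
n`, this turns the equation for `g` in arity `n` into a recursion. -/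
theorem BimoduleStr.extend_eq_of_arity {P Q : DGOperad K} {M X : DGSym K}
    (BX : BimoduleStr P Q X) {g g' : GrHom M.toGrSym X.toGrSym} {S : Set ℕ}
    (hg : ∀ v ∈ S, ∀ (i : ℤ) (m : M.obj v i), g.map v i m = g'.map v i m) {n : ℕ} {D : ℤ}
    {x : (freeObj P M Q).obj n D} (hx : x ∈ spanArity P.toGrSym M.toGrSym Q.toGrSym S n D) :
    (BX.extend g).map n D x = (BX.extend g').map n D x := by
  suffices h : spanArity P.toGrSym M.toGrSym Q.toGrSym S n D ≤
      LinearMap.eqLocus ((BX.extend g).map n D) ((BX.extend g').map n D) from h hx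
  refine Submodule.span_le.mpr ?_
  rintro _ ⟨k, i, p, l, z, e, h, hz, rfl⟩
  refine (BX.extend_mk g p z e h).trans (Eq.trans ?_ (BX.extend_mk g' p z e h).symm)
  refine congrArg (BX.lam.map n D) (Comp.mk_congr _ ?_ _ _ _)
  funext t
  obtain ⟨v, m, r, q, f, hv, hzt⟩ := hz t
  rw [hzt]
  refine congrArg (Sigma.mk _) ?_
  refine (BX.extendRight_mk g m.2 q f rfl).trans (Eq.trans ?_ (BX.extendRight_mk g' _ q f rfl).symm)
  rw [hg v hv]

/-- Every composite arises from generators in `M` by the right action and then the left action. Both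
are chain maps for `δ + ∂` and are respected by the extension, so commutation with the differentials
propagates from the generators that occur. -/
theorem QuasiFreeBimodule.mem_commSubmodule {P Q : DGOperad K} {M X : DGSym K}
    (N : QuasiFreeBimodule P M Q) (BX : BimoduleStr P Q X) {g : GrHom M.toGrSym X.toGrSym} {S : Set ℕ}
    (hg : ∀ v ∈ S, ∀ (i : ℤ) (m : M.obj v i), freeIncl P M Q m ∈
      GrHom.commSubmodule (X := (freeObj P M Q).twist N.tw N.isTwisting) (BX.extend g) v i)
    {n : ℕ} {D : ℤ} {x : (freeObj P M Q).obj n D}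
    (hx : x ∈ spanArity P.toGrSym M.toGrSym Q.toGrSym S n D) :
    x ∈ GrHom.commSubmodule (X := (freeObj P M Q).twist N.tw N.isTwisting) (BX.extend g) n D := by
  refine Submodule.span_le.mpr ?_ hx
  rintro _ ⟨k, i, p, l, z, e, h, hz, rfl⟩
  rw [← N.lam_mk_unitLeft p z e h]
  refine GrHom.map_mk_mem_commSubmodule (μ := N.str.lam) (μ' := BX.lam) (N.extend_lam BX g) e _
    (GrHom.mem_commSubmodule_id p) fun t => ?_
  obtain ⟨v, m, r, q, f, hv, hzt⟩ := hz t
  rw [hzt]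
  change Comp.unitLeft P.one (X := (M.comp Q.toDGSym).toGrSym) (Comp.mk m.2 q f rfl) ∈ _
  rw [← N.rho_mk_freeIncl]
  exact GrHom.map_mk_mem_commSubmodule (μ := N.str.rho) (μ' := BX.rho) (N.extend_rho BX g) f _
    (hg v hv _ _) fun s => GrHom.mem_commSubmodule_id (q s).2

theorem mem_spanArity_univ {P M Q : GrSym K} {n : ℕ} {D : ℤ} (x : Comp.Obj P (M.comp Q) n D) :
    x ∈ spanArity P M Q Set.univ n D := by
  suffices h : (spanArity P M Q Set.univ n D).mkQ = 0 by
    have hx := LinearMap.congr_fun h x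
    simpa using hx
  refine Comp.hom_ext ?_
  rintro ⟨p, z, e, h⟩
  simp only [Submodule.mkQ_apply, LinearMap.zero_apply, Submodule.Quotient.mk_eq_zero]
  refine Comp.mk_mem_of_span _ (Comp.IsPure M Q) p e ?_ z h fun t => Comp.mem_span_isPure (z t).2
  intro z h hz
  refine Submodule.subset_span ⟨_, _, p, _, z, e, h, fun t => ?_, rfl⟩
  obtain ⟨v, m, r, q, f, hq⟩ := hz t
  exact ⟨v, m, r, q, f, Set.mem_univ v, hq⟩

/-! ### Differentials of units -/

theorem DGOperad.d_one_eq_zero (P : DGOperad K) {j : ℤ} (h : j + 1 = 0) :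
    P.d.map 1 0 j h P.one = 0 := by
  obtain rfl : j = -1 := by linarith
  exact P.d_one

theorem Comp.d_unitLeft {P : DGOperad K} {X : DGSym K} {n : ℕ} {i j : ℤ} (h : j + 1 = i)
    (x : X.obj n i) :
    (P.toDGSym.comp X).d.map n i j h (Comp.unitLeft P.one x) =
      Comp.unitLeft P.one (X.d.map n i j h x) := by
  obtain rfl : j = i - 1 := by linarith
  refine (Comp.lift_gen _ (Comp.dGen_rel P.d X.d h) _).trans ?_
  have h1 : ∀ d : Fin 1 → ℤ, prefixSign 0 d 0 = 1 := by simp [prefixSign]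
  simp only [Comp.dGen, Fin.sum_univ_one]
  rw [h1, P.d_one_eq_zero, Comp.mk_zero_left, zero_add]
  refine (one_smul ℤˣ _).trans (Comp.mk_congr _ ?_ _ _ _)
  funext t
  obtain rfl := Subsingleton.elim 0 t
  rfl

theorem Comp.d_unitRight {Q : DGOperad K} {X : DGSym K} {n : ℕ} {i j : ℤ} (h : j + 1 = i)
    (x : X.obj n i) :
    (X.comp Q.toDGSym).d.map n i j h (Comp.unitRight Q.one x) =
      Comp.unitRight Q.one (X.d.map n i j h x) := by
  obtain rfl : j = i - 1 := by linarith
  refine (Comp.lift_gen _ (Comp.dGen_rel X.d Q.d h) _).trans ?_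
  refine (congrArg (_ + ·) (Finset.sum_eq_zero fun t _ => ?_)).trans (add_zero _)
  refine (congrArg (_ • ·) (Comp.mk_eq_zero_of_right x _ _ _ t ?_)).trans (smul_zero _)
  dsimp only
  rw [Function.update_self]
  exact Q.d_one_eq_zero _

theorem d_freeIncl (P : DGOperad K) (M : DGSym K) (Q : DGOperad K) {n : ℕ} {i j : ℤ}
    (h : j + 1 = i) (m : M.obj n i) :
    (freeObj P M Q).d.map n i j h (freeIncl P M Q m) = freeIncl P M Q (M.d.map n i j h m) :=
  (Comp.d_unitLeft h _).trans (congrArg _ (Comp.d_unitRight h m))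

/-! ### Acyclic fibrations and mapping cones -/

/-- The kernel of an acyclic fibration is acyclic. -/
theorem DGHom.IsWeakEquiv.exists_lift {X Y : DGSym K} {p : DGHom X Y} (hp : p.IsWeakEquiv)
    (hf : p.IsFibration) {n : ℕ} {i j : ℤ} (h : j + 1 = i) (x : X.obj n j)
    (hx : ∀ k (h' : k + 1 = j), X.d.map n j k h' x = 0) (hpx : p.map n j x = 0) :
    ∃ w, X.d.map n i j h w = x ∧ p.map n i w = 0 := by
  subst h
  obtain ⟨z, hz⟩ := hp.homology_inj n j x (hx _ _) ⟨0, by rw [map_zero, hpx]⟩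
  have hz' : Y.d.map n (j + 1) (j + 1 - 1) (by ring) (p.map n (j + 1) z) = 0 := by
    have : ∀ k (hk : k + 1 = j + 1), Y.d.map n (j + 1) k hk (p.map n (j + 1) z) = 0 := by
      intro k hk
      obtain rfl : k = j := by linarith
      rw [← p.map_d, hz, hpx]
    exact this _ _
  -- The primitive `z` of `x` need not lie in the kernel, but `p z` is a cycle, so it is homologous
  -- to the image of a cycle `x'`. Subtracting `x'` and adding the boundary of a preimage `w` of `y`
  -- corrects `z` without changing its boundary.
  obtain ⟨x', hx', y, hy⟩ := hp.homology_surj n (j + 1) _ hz'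
  obtain ⟨w, rfl⟩ := hf n (j + 1 + 1) y
  refine ⟨z - x' + X.d.map n (j + 1 + 1) (j + 1) rfl w, ?_, ?_⟩
  · have : ∀ k (hk : k + 1 = j + 1), X.d.map n (j + 1) k hk x' = 0 := by
      intro k hk
      obtain rfl : k = j + 1 - 1 := by linarith
      exact hx'
    rw [map_add, map_sub, X.d_d, this, hz, sub_zero, add_zero]
  · rw [map_add, map_sub, p.map_d, hy]
    abel

/-- A fibration with an acyclic kernel is acyclic. -/
theorem DGHom.IsFibration.isWeakEquiv {X Y : DGSym K} {p : DGHom X Y} (hf : p.IsFibration)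
    (H : ∀ (n : ℕ) (i j : ℤ) (h : j + 1 = i) (x : X.obj n j),
      (∀ k (h' : k + 1 = j), X.d.map n j k h' x = 0) → p.map n j x = 0 →
      ∃ w, X.d.map n i j h w = x ∧ p.map n i w = 0) : p.IsWeakEquiv where
  homology_inj n i x hx := by
    rintro ⟨y, hy⟩
    obtain ⟨w, rfl⟩ := hf n (i + 1) y
    -- Once the bounding element of `p x` is lifted to `w`, the difference `x - dw` is a cycle in
    -- the kernel.
    obtain ⟨u, hu, -⟩ := H n (i + 1) i rfl (x - X.d.map n (i + 1) i rfl w) (by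
      intro k hk
      obtain rfl : k = i - 1 := by linarith
      rw [map_sub, hx, X.d_d, sub_zero]) (by rw [map_sub, p.map_d, hy, sub_self])
    exact ⟨w + u, by rw [map_add, hu, add_sub_cancel]⟩
  homology_surj n i y hy := by
    obtain ⟨x, rfl⟩ := hf n i y
    obtain ⟨u, hu, hpu⟩ := H n i (i - 1) (by ring) (X.d.map n i (i - 1) (by ring) x)
      (fun k hk => X.d_d _ _ _ _ _ _ _) (by rw [p.map_d, hy])
    exact ⟨x - u, by rw [map_sub, hu, sub_self], 0, by rw [map_sub, hpu, map_zero, sub_zero, sub_self]⟩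

/-- The mapping cone of a morphism `p : X → Y`, with `Y_i ⊕ X_{i-1}` in degree `i`. -/
abbrev DGHom.cone {X Y : DGSym K} (p : DGHom X Y) : DGSym K where
  -- The product over the one-point type of `j` with `j + 1 = i` stands for degree `i - 1` and
  -- avoids transport along equalities of degrees.
  obj n i := Y.obj n i × ∀ j : {j : ℤ // j + 1 = i}, X.obj n j
  act n i :=
    { toFun := fun σ => (Y.act n i σ).prodMap
        (LinearMap.pi fun j => (X.act n j σ).comp (LinearMap.proj j))
      map_one' := by
        refine LinearMap.ext fun x => ?_
        simp only [map_one]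
        rfl
      map_mul' := fun σ τ => by
        refine LinearMap.ext fun x => ?_
        simp only [map_mul]
        rfl }
  d :=
    { map := fun n i j h =>
        ((Y.d.map n i j h).comp (LinearMap.fst K _ _) -
          (p.map n j).comp ((LinearMap.proj (⟨j, h⟩ : {j : ℤ // j + 1 = i})).comp
            (LinearMap.snd K _ _))).prod
        (-(LinearMap.pi fun k : {k : ℤ // k + 1 = j} => (X.d.map n j k k.2).comp
          ((LinearMap.proj (⟨j, h⟩ : {j : ℤ // j + 1 = i})).comp (LinearMap.snd K _ _))))
      map_act := by
        intro n i j h σ x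
        refine Prod.ext ?_ ?_
        · change Y.d.map n i j h (Y.act n i σ x.1) - p.map n j (X.act n j σ (x.2 ⟨j, h⟩)) =
            Y.act n j σ (Y.d.map n i j h x.1 - p.map n j (x.2 ⟨j, h⟩))
          rw [Y.d.map_act, p.map_act, map_sub]
        · funext ⟨k, h'⟩
          change -X.d.map n j k h' (X.act n j σ (x.2 ⟨j, h⟩)) =
            X.act n k σ (-X.d.map n j k h' (x.2 ⟨j, h⟩))
          rw [X.d.map_act, map_neg] }
  d_d n i j k h h' x := by
    refine Prod.ext ?_ ?_
    · change Y.d.map n j k h' (Y.d.map n i j h x.1 - p.map n j (x.2 ⟨j, h⟩)) -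
        p.map n k (-X.d.map n j k h' (x.2 ⟨j, h⟩)) = 0
      rw [map_sub, Y.d_d, map_neg, p.map_d]
      abel
    · funext ⟨k', h''⟩
      change -X.d.map n k k' h'' (-X.d.map n j k h' (x.2 ⟨j, h⟩)) = 0
      rw [map_neg, X.d_d, neg_zero, neg_zero]

/-- The identity morphism. -/
def DGHom.id (X : DGSym K) : DGHom X X where
  toGrHom := GrHom.id X.toGrSym
  map_d _ _ _ _ _ := rfl

/-- The morphism from the cone of the identity of `X` to the cone of `p : X → Y`. -/
def DGHom.coneMap {X Y : DGSym K} (p : DGHom X Y) : DGHom (DGHom.id X).cone p.cone where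
  map n i := (p.map n i).prodMap LinearMap.id
  map_act n i σ x := Prod.ext (p.map_act n i σ x.1) rfl
  map_d n i j h x := by
    refine Prod.ext ?_ rfl
    change p.map n j (X.d.map n i j h x.1 - x.2 ⟨j, h⟩) =
      Y.d.map n i j h (p.map n i x.1) - p.map n j (x.2 ⟨j, h⟩)
    rw [map_sub, p.map_d]

theorem DGHom.coneMap_isFibration {X Y : DGSym K} {p : DGHom X Y} (hp : p.IsFibration) :
    p.coneMap.IsFibration := by
  rintro n i ⟨y, x⟩
  obtain ⟨z, rfl⟩ := hp n i y
  exact ⟨(z, x), rfl⟩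

/-- The map is the identity on the shifted copy of `X`, so its kernel is that of `p`, which is
acyclic. -/
theorem DGHom.coneMap_isWeakEquiv {X Y : DGSym K} {p : DGHom X Y} (hf : p.IsFibration)
    (hw : p.IsWeakEquiv) : p.coneMap.IsWeakEquiv := by
  refine (DGHom.coneMap_isFibration hf).isWeakEquiv ?_
  rintro n i j h ⟨x, x'⟩ hx hpx
  obtain rfl : x' = 0 := congrArg Prod.snd hpx
  obtain ⟨w, hw, hpw⟩ := hw.exists_lift hf h x (fun k h' => by
    have h1 : X.d.map n j k h' x - 0 = 0 := congrArg Prod.fst (hx k h')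
    rwa [sub_zero] at h1) (congrArg Prod.fst hpx)
  refine ⟨(w, 0), Prod.ext ?_ ?_, Prod.ext hpw rfl⟩
  · change X.d.map n i j h w - 0 = x
    rw [hw, sub_zero]
  · funext ⟨k, h'⟩
    change -X.d.map n j k h' 0 = 0
    rw [map_zero, neg_zero]

/-- Lifting of morphisms up to a prescribed boundary, in a given arity. -/
theorem DGSym.IsCofibrant.exists_lift {M X Y : DGSym K} (hM : M.IsCofibrant) {p : DGHom X Y}
    (hf : p.IsFibration) (hw : p.IsWeakEquiv) (f : GrHom M.toGrSym Y.toGrSym) (n : ℕ)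
    (φ : ∀ (v : ℕ) (i j : ℤ), j + 1 = i → (M.obj v i →ₗ[K] X.obj v j))
    (hφ : ∀ i j h (σ : Equiv.Perm (Fin n)) m,
      φ n i j h (M.act n i σ m) = X.act n j σ (φ n i j h m))
    (hφd : ∀ i j k h h' m, X.d.map n j k h' (φ n i j h m) = -φ n j k h' (M.d.map n i j h m))
    (hfd : ∀ i j h m, Y.d.map n i j h (f.map n i m) =
      f.map n j (M.d.map n i j h m) + p.map n j (φ n i j h m)) :
    ∃ g : GrHom M.toGrSym X.toGrSym, ∀ i m, p.map n i (g.map n i m) = f.map n i m ∧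
      ∀ j h, X.d.map n i j h (g.map n i m) = g.map n j (M.d.map n i j h m) + φ n i j h m := by
  -- The conditions on `f` and `φ` are assumed in arity `n` only. Arities do not interact in a
  -- `Σ_*`-module, so the map to the cone is set to `0` in the others.
  obtain ⟨F, hpos, hneg⟩ : ∃ F : ∀ v i, M.obj v i →ₗ[K] p.cone.obj v i,
      (∀ i m, F n i m = (f.map n i m, fun j : {j : ℤ // j + 1 = i} => φ n i j j.2 m)) ∧
      ∀ v, v ≠ n → ∀ i, F v i = 0 :=
    ⟨fun v i => if v = n then (f.map v i).prod (LinearMap.pi fun j => φ v i j j.2) else 0,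
      fun i m => LinearMap.congr_fun (if_pos rfl) m, fun v hv i => if_neg hv⟩
  let F' : DGHom M p.cone :=
    { map := F
      map_act := by
        intro v i σ m
        by_cases h : v = n
        · subst h
          rw [hpos, hpos]
          exact Prod.ext (f.map_act _ _ _ _) (funext fun j => hφ _ _ _ _ _)
        · rw [hneg v h, LinearMap.zero_apply, LinearMap.zero_apply, map_zero]
      map_d := by
        intro v i j hj m
        by_cases h : v = n
        · subst h
          rw [hpos, hpos]
          refine Prod.ext ?_ (funext fun ⟨k, hk⟩ => ?_)
          · change f.map v j (M.d.map v i j hj m) =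
              Y.d.map v i j hj (f.map v i m) - p.map v j (φ v i j hj m)
            rw [hfd, add_sub_cancel_right]
          · change φ v j k hk (M.d.map v i j hj m) = -X.d.map v j k hk (φ v i j hj m)
            rw [hφd, neg_neg]
        · rw [hneg v h, hneg v h, LinearMap.zero_apply, LinearMap.zero_apply, map_zero] }
  obtain ⟨G, hG⟩ := hM _ _ p.coneMap (DGHom.coneMap_isFibration hf)
    (DGHom.coneMap_isWeakEquiv hf hw) F'
  have hG' : ∀ i m, p.coneMap.map n i (G.map n i m) = (f.map n i m, fun j : {j : ℤ // j + 1 = i} => φ n i j j.2 m) :=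
    fun i m => (hG n i m).trans (hpos i m)
  refine ⟨⟨fun v i => (LinearMap.fst K _ _).comp (G.map v i), fun v i σ m =>
    congrArg Prod.fst (G.map_act v i σ m)⟩, fun i m => ⟨congrArg Prod.fst (hG' i m), fun j h => ?_⟩⟩
  -- The first component of the chain map equation for `G`, whose second component is `φ`, reads
  -- `g(dm) = d g(m) - φ(m)`.
  have h1 : (G.map n j (M.d.map n i j h m)).1 =
      X.d.map n i j h (G.map n i m).1 - (G.map n i m).2 ⟨j, h⟩ :=
    congrArg Prod.fst (G.map_d n i j h m)
  have h2 : (G.map n i m).2 ⟨j, h⟩ = φ n i j h m :=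
    congrFun (congrArg Prod.snd (hG' i m)) ⟨j, h⟩
  change X.d.map n i j h (G.map n i m).1 = (G.map n j (M.d.map n i j h m)).1 + φ n i j h m
  rw [h1, h2, sub_add_cancel]

/-! ### Cofibrancy of quasi-free bimodules -/

/-- Morphisms `g : M → X` such that, in the arities that belong to `S`, the extension of `g` to
`(P ∘ M ∘ Q, ∂)` lifts `f` and commutes with the differentials on `M`. -/
def QuasiFreeBimodule.IsPartialLift {P Q : DGOperad K} {M X Y : DGSym K}
    (N : QuasiFreeBimodule P M Q) (BX : BimoduleStr P Q X) (p : DGHom X Y)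
    (f : GrHom M.toGrSym Y.toGrSym) (S : Set ℕ) (g : GrHom M.toGrSym X.toGrSym) : Prop :=
  ∀ v ∈ S, ∀ (i : ℤ) (m : M.obj v i), p.map v i (g.map v i m) = f.map v i m ∧
    freeIncl P M Q m ∈
      GrHom.commSubmodule (X := (freeObj P M Q).twist N.tw N.isTwisting) (BX.extend g) v i

/-- On `M` the extension is `g` and `δ` restricts to the differential of `M`, because units are
cycles. Commutation thus becomes the twisted equation solved by `DGSym.IsCofibrant.exists_lift`. -/
theorem QuasiFreeBimodule.freeIncl_mem_commSubmodule {P Q : DGOperad K} {M X : DGSym K}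
    {N : QuasiFreeBimodule P M Q} {BX : BimoduleStr P Q X}
    {g : GrHom M.toGrSym X.toGrSym} {n : ℕ} {i : ℤ} {m : M.obj n i} :
    freeIncl P M Q m ∈
      GrHom.commSubmodule (X := (freeObj P M Q).twist N.tw N.isTwisting) (BX.extend g) n i ↔
    ∀ j h, X.d.map n i j h (g.map n i m) = g.map n j (M.d.map n i j h m) +
      (BX.extend g).map n j (N.tw.map n i j h (freeIncl P M Q m)) := by
  rw [GrHom.mem_commSubmodule]
  refine forall_congr' fun j => forall_congr' fun h => ?_
  have h1 : (BX.extend g).map n i (freeIncl P M Q m) = g.map n i m := BX.extend_freeIncl g m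
  have h2 : (BX.extend g).map n j (((freeObj P M Q).twist N.tw N.isTwisting).d.map n i j h
      (freeIncl P M Q m)) = g.map n j (M.d.map n i j h m) +
        (BX.extend g).map n j (N.tw.map n i j h (freeIncl P M Q m)) := by
    refine (congrArg ((BX.extend g).map n j) (LinearMap.add_apply _ _ _)).trans ?_
    refine (map_add _ _ _).trans (congrArg (· + _) ?_)
    refine (congrArg ((BX.extend g).map n j) (d_freeIncl P M Q h m)).trans ?_
    exact BX.extend_freeIncl g _
  rw [h1, h2]

/-- The inclusion `M → P ∘ M ∘ Q` as a morphism. -/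
def GrHom.freeIncl (P : DGOperad K) (M : DGSym K) (Q : DGOperad K) :
    GrHom M.toGrSym (freeObj P M Q).toGrSym :=
  (GrHom.unitRight Q.one M.toGrSym).trans (GrHom.unitLeft P.one (M.comp Q.toDGSym).toGrSym)

/-- A graded morphism that coincides with `g` in arity `n` and with `g'` in other arities. -/
theorem GrHom.exists_piecewise {X Y : GrSym K} (g g' : GrHom X Y) (n : ℕ) :
    ∃ g'' : GrHom X Y, (∀ i, g''.map n i = g.map n i) ∧
      ∀ v, v ≠ n → ∀ i, g''.map v i = g'.map v i :=
  ⟨⟨fun v i => if v = n then g.map v i else g'.map v i, fun v i σ x => by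
    split_ifs
    · exact g.map_act v i σ x
    · exact g'.map_act v i σ x⟩, fun i => if_pos rfl, fun v hv i => if_neg hv⟩

/-- The inductive step: the obstruction `φ(m) = ext_g(∂m)` in arity `n` involves lower arities only,
so `g` can be redefined in arity `n` without disturbing it. Keeping the lower values is what allows
the passage to the limit. -/
theorem QuasiFreeBimodule.IsPartialLift.extend_succ {P Q : DGOperad K} {M X Y : DGSym K}
    {N : QuasiFreeBimodule P M Q} (hN : N.IsDecomposable) (hM₀ : M.toGrSym.Connected)
    (hQ : Q.toGrSym.Connected) (hM : M.IsCofibrant) {BX : BimoduleStr P Q X}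
    {BY : BimoduleStr P Q Y} {p : DGHom X Y} (hp : IsBimoduleHom BX BY p) (hpf : p.IsFibration)
    (hpw : p.IsWeakEquiv) {f : DGHom ((freeObj P M Q).twist N.tw N.isTwisting) Y}
    (hf : IsBimoduleHom N.str BY f) {n : ℕ} {g : GrHom M.toGrSym X.toGrSym}
    (hg : N.IsPartialLift BX p (GrHom.restrictFree f.toGrHom) (Set.Iio n) g) :
    ∃ g' : GrHom M.toGrSym X.toGrSym,
      N.IsPartialLift BX p (GrHom.restrictFree f.toGrHom) (Set.Iio (n + 1)) g' ∧
        ∀ v < n, ∀ i m, g'.map v i m = g.map v i m := by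
  have htw : ∀ {i j} (h : j + 1 = i) (m : M.obj n i),
      N.tw.map n i j h (freeIncl P M Q m) ∈
        spanArity P.toGrSym M.toGrSym Q.toGrSym (Set.Iio n) n j :=
    fun h m => hN.mem_spanArity hM₀ hQ h m
  obtain ⟨g₁, hg₁⟩ := hM.exists_lift hpf hpw (GrHom.restrictFree f.toGrHom) n
    (fun v i j h => ((BX.extend g).map v j).comp ((N.tw.map v i j h).comp
      ((GrHom.freeIncl P M Q).map v i)))
    (by
      intro i j h σ m
      simp only [LinearMap.comp_apply]
      rw [(GrHom.freeIncl P M Q).map_act, N.tw.map_act, (BX.extend g).map_act])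
    (by
      intro i j k h h' m
      -- Since `∂m` is built from arities `< n`, the extension commutes with the differentials at
      -- `∂m`: `dφ(m) = ext_g((δ + ∂)∂m)`. The twisting equation replaces `(δ + ∂)∂m` by `-∂δm`.
      have h1 := GrHom.mem_commSubmodule.mp
        (N.mem_commSubmodule BX (fun v hv i m => (hg v hv i m).2) (htw h m)) k h'
      refine h1.trans ?_
      have h2 := N.isTwisting n i j k h h' (freeIncl P M Q m)
      rw [d_freeIncl, add_right_comm] at h2
      refine (congrArg ((BX.extend g).map n k) (eq_neg_of_add_eq_zero_left h2)).trans ?_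
      exact map_neg _ _)
    (by
      intro i j h m
      have h1 := f.map_d n i j h (freeIncl P M Q m)
      refine h1.symm.trans ((congrArg (f.map n j) (LinearMap.add_apply _ _ _)).trans ?_)
      refine (map_add _ _ _).trans (congrArg₂ (· + ·) ?_ ?_)
      · exact congrArg (f.map n j) (d_freeIncl P M Q h m)
      -- Both `f` and `p ∘ ext_g` are extensions from `M`, of `f` restricted to `M` and of `p g`;
      -- these agree in arities `< n`, hence at `∂m`.
      · refine (hf.eq_extend _).trans (Eq.trans ?_ (hp.map_extend g _).symm)
        exact BY.extend_eq_of_arity (fun v hv i m => ((hg v hv i m).1).symm) (htw h m))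
  obtain ⟨g', hn, hne⟩ := GrHom.exists_piecewise g₁ g n
  have hlt : ∀ v < n, ∀ i m, g'.map v i m = g.map v i m := fun v hv i m => by
    rw [hne v hv.ne]
  refine ⟨g', fun v hv i m => ?_, hlt⟩
  rw [freeIncl_mem_commSubmodule]
  have hv' : v ≤ n := Nat.lt_succ_iff.mp hv
  -- For `v ≤ n`, the twisting term involves arities `< v ≤ n`, where `g'` and `g` agree.
  have hext : ∀ {j} (h : j + 1 = i),
      (BX.extend g').map v j (N.tw.map v i j h (freeIncl P M Q m)) =
        (BX.extend g).map v j (N.tw.map v i j h (freeIncl P M Q m)) := fun h =>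
    BX.extend_eq_of_arity (fun w hw => hlt w (lt_of_lt_of_le hw hv'))
      (hN.mem_spanArity hM₀ hQ h m)
  rcases hv'.eq_or_lt with rfl | hv
  · refine ⟨by rw [hn, (hg₁ i m).1], fun j h => ?_⟩
    rw [hn, hn, hext]
    exact (hg₁ i m).2 j h
  · obtain ⟨h1, h2⟩ := hg v hv i m
    refine ⟨by rw [hlt v hv, h1], fun j h => ?_⟩
    rw [hlt v hv, hlt v hv, hext]
    exact freeIncl_mem_commSubmodule.mp h2 j h

theorem QuasiFreeBimodule.exists_partialLift_univ {P Q : DGOperad K} {M X Y : DGSym K}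
    {N : QuasiFreeBimodule P M Q} (hN : N.IsDecomposable) (hM₀ : M.toGrSym.Connected)
    (hQ : Q.toGrSym.Connected) (hM : M.IsCofibrant) {BX : BimoduleStr P Q X}
    {BY : BimoduleStr P Q Y} {p : DGHom X Y} (hp : IsBimoduleHom BX BY p) (hpf : p.IsFibration)
    (hpw : p.IsWeakEquiv) {f : DGHom ((freeObj P M Q).twist N.tw N.isTwisting) Y}
    (hf : IsBimoduleHom N.str BY f) :
    ∃ g : GrHom M.toGrSym X.toGrSym,
      N.IsPartialLift BX p (GrHom.restrictFree f.toGrHom) Set.univ g := by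
  let L : ℕ → Type u := fun n => {g : GrHom M.toGrSym X.toGrSym //
    N.IsPartialLift BX p (GrHom.restrictFree f.toGrHom) (Set.Iio n) g}
  have hstep : ∀ n (g : L n), ∃ g' : L (n + 1), ∀ v < n, ∀ i m,
      g'.1.map v i m = g.1.map v i m := fun n g => by
    obtain ⟨g', h, h'⟩ := g.2.extend_succ hN hM₀ hQ hM hp hpf hpw hf
    exact ⟨⟨g', h⟩, h'⟩
  choose next hnext using hstep
  -- The recursion starts from the zero morphism, on which no condition is imposed in arities `< 0`.
  let g : ∀ n, L n := fun n => Nat.rec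
    ⟨⟨fun _ _ => 0, fun _ _ _ _ => (map_zero _).symm⟩, fun v hv => absurd hv (Nat.not_lt_zero v)⟩
    (fun n g => next n g) n
  have hg : ∀ v n, v < n → ∀ i m, (g n).1.map v i m = (g (v + 1)).1.map v i m := by
    intro v n hvn i m
    induction n, hvn using Nat.le_induction with
    | base => rfl
    | succ n hn ih => exact (hnext n (g n) v hn i m).trans ih
  -- Stage `v + 1` is the first at which arity `v` is settled, and later stages keep it, so the
  -- diagonal is the limit.
  refine ⟨⟨fun v i => (g (v + 1)).1.map v i, fun v i => (g (v + 1)).1.map_act v i⟩,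
    fun v _ i m => ?_⟩
  obtain ⟨h1, h2⟩ := (g (v + 1)).2 v (Nat.lt_succ_self v) i m
  refine ⟨h1, ?_⟩
  rw [freeIncl_mem_commSubmodule] at h2 ⊢
  intro j h
  rw [h2 j h]
  refine congrArg _ (BX.extend_eq_of_arity ?_ (hN.mem_spanArity hM₀ hQ h m))
  exact fun w hw i m => hg w (v + 1) (lt_trans hw (Nat.lt_succ_self v)) i m

end

theorem mainTheorem8 {K : Type u} [CommRing K] (P Q : DGOperad.{u} K) (hP : P.IsConnected)
    (hQ : Q.IsConnected) (M : DGSym.{u} K) (hM₀ : M.toGrSym.Connected) (hM : M.IsCofibrant)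
    (N : QuasiFreeBimodule P M Q) (hN : N.IsDecomposable) : N.str.IsCofibrant := by
  intro X Y BX BY _ _ p hp hpf hpw f hf
  obtain ⟨g, hg⟩ :=
    N.exists_partialLift_univ hN hM₀ hQ.arity_zero hM hp hpf hpw hf
  refine ⟨⟨BX.extend g, fun n i j h x => ?_⟩, ⟨?_, ?_⟩, fun n i x => ?_⟩
  -- Commutation on all generators gives commutation everywhere, as composites with no restriction
  -- on arities span `P ∘ M ∘ Q`.
  · exact (GrHom.mem_commSubmodule.mp (N.mem_commSubmodule BX (fun v hv i m => (hg v hv i m).2)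
      (mem_spanArity_univ x)) j h).symm
  · intro k i p l x n D e h
    exact (N.extend_lam BX g n D _).trans
      (congrArg (BX.lam.map n D) (GrHom.compMap_mk _ _ p x e h))
  · intro k i x l q n D e h
    exact (N.extend_rho BX g n D _).trans
      (congrArg (BX.rho.map n D) (GrHom.compMap_mk _ _ x q e h))
  · refine (hp.map_extend g x).trans (Eq.trans ?_ (hf.eq_extend x).symm)
    exact BY.extend_eq_of_arity (fun v hv i m => (hg v hv i m).1) (mem_spanArity_univ x)
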